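/- Let $A\in\mathbb R^{n\times n}$ and let $B_{i\sigma}\in\mathbb R^{n}$ ($1\le i\le q$, $1\le\sigma\le p$, $q\ge 2$) satisfy $\sum_{i=1}^{q}B_{i\sigma}=0$ for every $\sigma$. Put $\mathbf A=I_q\otimes A$, let $\mathbf B\in\mathbb R^{qn\times p}$ be the matrix whose $\sigma$th column stacks $B_{1\sigma},\dots,B_{q\sigma}$, and let $$\mathcal R=\Big\{\int_0^\tau e^{\mathbf A(\tau-t)}\mathbf B\,u(t)\,dt\ :\ \tau\ge 0,\ u:[0,\tau]\to\mathbb R^p_{\ge 0}\ \text{integrable}\Big\},\qquad \mathcal R^\circ=\{\eta\in(\mathbb R^{n})^{q}:\xi^*\eta\le 0\ \text{for all}\ \xi\in\mathcal R\}.$$ Let $\mu_1,\dots,\mu_m$ be the distinct (complex) eigenvalues of $A^*$, ordered so that $\mathrm{Re}\,\mu_1\ge\dots\ge\mathrm{Re}\,\mu_m$ and so that $\mathrm{Re}\,\mu_\kappa=\mu_\nu$ with $\kappa\ne\nu$ implies $\kappa>\nu$; let $n_\kappa$ be the algebraic multiplicity of $\mu_\kappa$. Let $U_\kappa\in\mathbb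 C^{n\times n_\kappa}$ be any matrix of full column rank with $\mathrm{range}\,U_\kappa=\mathrm{null}\,[A^*-\mu_\kappa I_n]^{n_\kappa}$, chosen real when $\mu_\kappa$ is real, let $A_\kappa$ be the matrix with $A^*U_\kappa=U_\kappa A_\kappa^*$, and put $$\Lambda_\kappa=[A_\kappa^*-\mu_\kappa I_{n_\kappa}]^*,\qquad B^{[\kappa]}_{i\sigma}=U_\kappa^*B_{i\sigma},\qquad Q^{[\kappa]}_{i\sigma}=\big[B^{[\kappa]}_{i\sigma}\ \ \Lambda_\kappa B^{[\kappa]}_{i\sigma}\ \cdots\ \Lambda_\kappa^{n_\kappa-1}B^{[\kappa]}_{i\sigma}\big].$$ Let $B^{[\kappa]}_{:\sigma}$ be the stack of $B^{[\kappa]}_{1\sigma},\dots,B^{[\kappa]}_{q\sigma}$, and for $\mathcal I\subset\{1,\dots,p\}$ let $\mathrm{inc}(Q^{[\kappa]}_{:\sigma})_{\sigma\in\mathcal I}$ be the block matrix with blocks $Q^{[\kappa]}_{i\sigma}$ ($i$ the block row, $\sigma\in\mathcal I$ the block column). For a real matrix $G$ write $\mathrm{cone}\,G=\{G\alpha:\alpha\ge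 0\}$. Define the index sets by $\mathcal I_1=\{1,\dots,p\}$ and $\mathcal I_{\kappa+1}=\mathcal I_\kappa\setminus\mathcal I_\kappa^-$, where $\mathcal I_\kappa^-=\emptyset$ if $\mu_\kappa\notin\mathbb R$, while if $\mu_\kappa\in\mathbb R$, $$\mathcal I_\kappa^-=\{\sigma\in\mathcal I_\kappa:\ [I_q\otimes\Lambda_\kappa^r]B^{[\kappa]}_{:\sigma}\notin\mathcal Q_\kappa\ \text{for some}\ r\in\{0,\dots,n_\kappa-1\}\},$$ $\mathcal Q_\kappa\subset(\mathbb R^{n_\kappa})^q$ being the largest subspace contained in $\mathrm{cone}\,[\mathrm{inc}(Q^{[\kappa]}_{:\sigma})_{\sigma\in\mathcal I_\kappa}]$. Let $k\ne\ell$ be indices in $\{1,\dots,q\}$ and let $e_1,\dots,e_q$ be the unit $q$-vectors. A matrix $G$ with $qd$ rows is called $(k,\ell)$-connected if $\mathrm{range}\,G\supset\mathrm{range}\,[(e_k-e_\ell)\otimes I_d]$, and strongly $(k,\ell)$-connected if $G$ is real and $\mathrm{cone}\,G\supset\mathrm{range}\,[(e_k-e_\ell)\otimes I_d]$. Assume that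 $\Lambda_\kappa=0$ for every $\mu_\kappa\notin\mathbb R$ such that $\mathrm{Re}\,\mu_\kappa=\mu_\nu$ for some $\nu$. Then the following two conditions are equivalent. 1. $\mathcal R^\circ\subset\mathrm{null}\,[(e_k-e_\ell)^*\otimes I_n]$. 2. (a) $\mathrm{inc}(Q^{[\kappa]}_{:\sigma})_{\sigma\in\mathcal I_\kappa}$ is strongly $(k,\ell)$-connected for all $\mu_\kappa\in\mathbb R$, and (b) $\mathrm{inc}(Q^{[\kappa]}_{:\sigma})_{\sigma\in\mathcal I_\kappa}$ is $(k,\ell)$-connected for all $\mu_\kappa\notin\mathbb R$. -/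

import Mathlib

open scoped Matrix Kronecker
open MeasureTheory

noncomputable section

namespace RelArray

/-! ### Cones, polars and connectivity of block matrices -/

/-- `cone G = {G α : α ≥ 0}`, the convex cone positively spanned by the columns of a real matrix. -/
def cone {ι J : Type*} [Fintype J] (G : Matrix ι J ℝ) : PointedCone ℝ (ι → ℝ) where
  carrier := {ζ | ∃ α : J → ℝ, 0 ≤ α ∧ ζ = G *ᵥ α}
  add_mem' := by
    rintro _ _ ⟨α, hα, rfl⟩ ⟨β, hβ, rfl⟩
    exact ⟨α + β, add_nonneg hα hβ, (Matrix.mulVec_add G α β).symm⟩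
  zero_mem' := ⟨0, le_refl _, (Matrix.mulVec_zero G).symm⟩
  smul_mem' := by
    rintro c _ ⟨α, hα, rfl⟩
    exact ⟨(c : ℝ) • α, smul_nonneg c.2 hα, (Matrix.mulVec_smul G (c : ℝ) α).symm⟩

/-- The polar `{η : ξᵀ η ≤ 0 for all ξ ∈ K}` of a set of real vectors. -/
def polar {ι : Type*} [Fintype ι] (K : Set (ι → ℝ)) : Set (ι → ℝ) :=
  {η | ∀ ξ ∈ K, ξ ⬝ᵥ η ≤ 0}

/-- The block column `(e_k - e_ℓ) ⊗ I_d`. -/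
def diffBlock (R : Type*) [CommRing R] {q : ℕ} (k l : Fin q) (d : ℕ) :
    Matrix (Fin q × Fin d) (Unit × Fin d) R :=
  Matrix.replicateCol Unit (Pi.single k 1 - Pi.single l 1 : Fin q → R) ⊗ₖ
    (1 : Matrix (Fin d) (Fin d) R)

/-- `(k, ℓ)`-connectivity: `range G ⊇ range [(e_k - e_ℓ) ⊗ I_d]` (complex ranges). -/
def IsConn {q d : ℕ} {J : Type*} [Fintype J] (k l : Fin q)
    (G : Matrix (Fin q × Fin d) J ℂ) : Prop :=
  LinearMap.range (diffBlock ℂ k l d).mulVecLin ≤ LinearMap.range G.mulVecLin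

/-- Strong `(k, ℓ)`-connectivity: `G` is real and `cone G ⊇ range [(e_k - e_ℓ) ⊗ I_d]`. -/
def IsStronglyConn {q d : ℕ} {J : Type*} [Fintype J] (k l : Fin q)
    (G : Matrix (Fin q × Fin d) J ℂ) : Prop :=
  (∀ a b, (G a b).im = 0) ∧
    (LinearMap.range (diffBlock ℝ k l d).mulVecLin : Set (Fin q × Fin d → ℝ)) ⊆
      cone (G.map Complex.re)

/-! ### The array -/

/-- The matrix `inc (M_{:σ})_{σ ∈ s}` with blocks `M i σ`, `i` the block row, `σ ∈ s` the block
column. -/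
def inc {R : Type*} {q p d c : ℕ} (s : Finset (Fin p))
    (M : Fin q → Fin p → Matrix (Fin d) (Fin c) R) :
    Matrix (Fin q × Fin d) (s × Fin c) R :=
  Matrix.of fun a b => M a.1 b.1 a.2 b.2

/-- The state matrix `I_q ⊗ A` of the whole array. -/
def bigA {n : ℕ} (q : ℕ) (A : Matrix (Fin n) (Fin n) ℝ) :
    Matrix (Fin q × Fin n) (Fin q × Fin n) ℝ :=
  (1 : Matrix (Fin q) (Fin q) ℝ) ⊗ₖ A

/-- The input matrix of the whole array: its `σ`-th column stacks `B_{1σ}, …, B_{qσ}`. -/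
def bigB {n q p : ℕ} (B : Fin q → Fin p → Fin n → ℝ) : Matrix (Fin q × Fin n) (Fin p) ℝ :=
  Matrix.of fun a σ => B a.1 σ a.2

/-- The states reachable from the origin in finite time with nonnegative (integrable) inputs. -/
def posReach {n q p : ℕ} (A : Matrix (Fin n) (Fin n) ℝ) (B : Fin q → Fin p → Fin n → ℝ) :
    Set (Fin q × Fin n → ℝ) :=
  {ξ | ∃ τ : ℝ, 0 ≤ τ ∧ ∃ u : ℝ → Fin p → ℝ,
    IntegrableOn u (Set.Icc 0 τ) ∧ (∀ t ∈ Set.Icc 0 τ, 0 ≤ u t) ∧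
    ξ = ∫ t in (0 : ℝ)..τ,
      NormedSpace.exp ((τ - t) • bigA q A) *ᵥ (bigB B *ᵥ u t)}

/-! ### Spectral data -/

/-- The conjugate transpose `A*` of the real matrix `A`, as a complex matrix. -/
def adj {n : ℕ} (A : Matrix (Fin n) (Fin n) ℝ) : Matrix (Fin n) (Fin n) ℂ :=
  (A.map Complex.ofReal)ᴴ

/-- `Λ = [N* - μ I]*`, for `N = A_κ` and `μ = μ_κ`. -/
def nilPart {d : ℕ} (μ : ℂ) (N : Matrix (Fin d) (Fin d) ℂ) : Matrix (Fin d) (Fin d) ℂ :=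
  (Nᴴ - μ • (1 : Matrix (Fin d) (Fin d) ℂ))ᴴ

/-- `U* B_{iσ}`. -/
def modalB {n q p d : ℕ} (U : Matrix (Fin n) (Fin d) ℂ) (B : Fin q → Fin p → Fin n → ℝ) :
    Fin q → Fin p → Fin d → ℂ :=
  fun i σ => Uᴴ *ᵥ (fun a => (B i σ a : ℂ))

/-- The `d × d` matrices `[b_{iσ}  Λ b_{iσ}  ⋯  Λ^{d-1} b_{iσ}]`. -/
def modalQ {q p d : ℕ} (Λ : Matrix (Fin d) (Fin d) ℂ) (b : Fin q → Fin p → Fin d → ℂ) :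
    Fin q → Fin p → Matrix (Fin d) (Fin d) ℂ :=
  fun i σ => Matrix.of fun a r => (Λ ^ (r : ℕ) *ᵥ b i σ) a

/-- The vector `[I_q ⊗ Λ^r] b_{:σ}`. -/
def modalVec {q p d : ℕ} (Λ : Matrix (Fin d) (Fin d) ℂ) (b : Fin q → Fin p → Fin d → ℂ)
    (r : ℕ) (σ : Fin p) : Fin q × Fin d → ℂ :=
  ((1 : Matrix (Fin q) (Fin q) ℂ) ⊗ₖ (Λ ^ r)) *ᵥ (fun a => b a.1 σ a.2)

/-- The largest subspace contained in `cone [inc (Q_{:σ})_{σ ∈ s}]`. It is used for real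
eigenvalues only, where `Q` is a real matrix and `re` changes nothing. -/
def modalSubspace {q p d : ℕ} (Λ : Matrix (Fin d) (Fin d) ℂ) (b : Fin q → Fin p → Fin d → ℂ)
    (s : Finset (Fin p)) : Submodule ℝ (Fin q × Fin d → ℝ) :=
  (cone ((inc s (modalQ Λ b)).map Complex.re)).lineal

open Classical in
/-- The inputs removed from the index set `s` at the eigenvalue `μ`: those `σ ∈ s` for which some
`[I_q ⊗ Λ^r] b_{:σ}` lies outside the largest subspace, if `μ` is real; none otherwise. -/
def removed {q p d : ℕ} (μ : ℂ) (Λ : Matrix (Fin d) (Fin d) ℂ)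
    (b : Fin q → Fin p → Fin d → ℂ) (s : Finset (Fin p)) : Finset (Fin p) :=
  if μ.im = 0 then
    s.filter fun σ => ∃ r < d, (fun a => (modalVec Λ b r σ a).re) ∉ modalSubspace Λ b s
  else ∅

/-- The index sets: all inputs for the first eigenvalue, and from one eigenvalue to the next the
removed inputs are dropped. Positions are counted from `0`. -/
def indexSet {q p m : ℕ} {d : Fin m → ℕ} (μ : Fin m → ℂ)
    (Λ : ∀ κ, Matrix (Fin (d κ)) (Fin (d κ)) ℂ) (b : ∀ κ, Fin q → Fin p → Fin (d κ) → ℂ) :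
    ℕ → Finset (Fin p)
  | 0 => Finset.univ
  | j + 1 =>
    if h : j < m then
      indexSet μ Λ b j \ removed (μ ⟨j, h⟩) (Λ ⟨j, h⟩) (b ⟨j, h⟩) (indexSet μ Λ b j)
    else indexSet μ Λ b j

/-- `inc (Q^{[κ]}_{:σ})_{σ ∈ I_κ}`, from the eigenvalues `μ`, the matrices `U` of generalized
eigenvectors, and the matrices `N` representing the restrictions of the array to them. -/
def modeMatrix {n q p m : ℕ} {d : Fin m → ℕ} (B : Fin q → Fin p → Fin n → ℝ) (μ : Fin m → ℂ)
    (U : ∀ κ, Matrix (Fin n) (Fin (d κ)) ℂ) (N : ∀ κ, Matrix (Fin (d κ)) (Fin (d κ)) ℂ)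
    (κ : Fin m) :
    Matrix (Fin q × Fin (d κ))
      (indexSet μ (fun κ => nilPart (μ κ) (N κ)) (fun κ => modalB (U κ) B) κ × Fin (d κ)) ℂ :=
  inc _ (modalQ (nilPart (μ κ) (N κ)) (modalB (U κ) B))

end RelArray

end

/-! A vector `η` lies in the polar exactly when every impulse response `f_σ(t) = (e^{t𝐀} B_{:σ}) ⬝
η` is nonpositive for `t ≥ 0` (`mem_polar_posReach_iff`). Writing `η = ∑ U_κ c_κ` in generalized
eigenvectors of `A*` turns `f_σ` into `∑ e^{μ_κ t} P_κ(t)`, where `P_κ` collects the pairings of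
`c_κ` with the vectors `(I ⊗ Λ_κ^r) B_{:σ}`. Connectivity is dualized as well: it says that every
polar, respectively orthogonal, vector of the columns has equal blocks `k` and `l`.

From connectivity to the polar, the modes are peeled off in the order of the eigenvalues
(`eq_of_realResp_nonpos`). For an input still in the index set, all faster terms have already
vanished. A nonpositive function asymptotic to a trigonometric polynomial has all coefficients
bounded by minus its mean (`norm_coeff_le_neg_mean`). Hence at a real eigenvalue the leading
coefficient of `P_κ` is nonpositive, and `P_κ` and its derivatives are eventually nonpositive. These
derivatives are the pairings with the translate `exp(tΛᵀ) c_κ`, which therefore lies in the polar of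
the cone for large `t`. Strong connectivity then equates its blocks `k` and `l`, hence those of
`c_κ`; and inputs whose vectors lie in the lineality space have `P_κ = 0`, so the induction
continues. At a nonreal eigenvalue the mean is zero, which kills `P_κ` altogether.

Conversely, a polar vector `c` of one mode gives `U_κ c`, whose responses have the right sign only
for the inputs not yet removed. Each real mode that removed inputs supplies a vector `w` with zero
response to the inputs it keeps and response at most `-ε e^{μ t}` to those it removes
(`exists_removing_vector`). Adding large multiples of such vectors, going back through the modes,
leads to the polar (`eq_of_realResp_le`). The multiple is arbitrary beyond a bound, so the equality
of blocks passes to the vector itself. The assumption `Λ = 0` keeps a nonreal mode from outgrowing a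
real one of equal real part. -/

noncomputable section

namespace RelArray

/-! ### Finitely generated cones, Farkas duality and dual forms of connectivity. -/

section

/-- Farkas' lemma for finitely many linear functionals, by induction on their number. -/
theorem farkas_functional {V J : Type*} [AddCommGroup V] [Module ℝ V] (s : Finset J) :
    ∀ (a : J → V →ₗ[ℝ] ℝ) (b : V →ₗ[ℝ] ℝ),
      (∀ x, (∀ j ∈ s, a j x ≤ 0) → b x ≤ 0) →
        ∃ w : J → ℝ, (∀ j, 0 ≤ w j) ∧ b = ∑ j ∈ s, w j • a j := by
  classical
  induction s using Finset.induction_on with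
  | empty =>
    intro a b h
    refine ⟨0, fun _ => le_refl _, ?_⟩
    ext x
    have h1 := h x (by simp)
    have h2 := h (-x) (by simp)
    simp only [map_neg] at h2
    simp
    linarith
  | insert j₀ s hj ih =>
    intro a b h
    by_cases h0 : ∀ x, (∀ j ∈ s, a j x ≤ 0) → b x ≤ 0
    · obtain ⟨w, hw, hb⟩ := ih a b h0
      refine ⟨Function.update w j₀ 0, fun j => ?_, ?_⟩
      · by_cases hjj : j = j₀
        · subst hjj; simp
        · simp [hjj, hw]
      · rw [Finset.sum_insert hj, hb]
        simp only [Function.update_self, zero_smul, zero_add]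
        refine Finset.sum_congr rfl fun j hjs => ?_
        rw [Function.update_of_ne (ne_of_mem_of_not_mem hjs hj)]
    · push Not at h0
      obtain ⟨x0, hx0, hbx0⟩ := h0
      have hpos : 0 < a j₀ x0 := by
        by_contra hn
        exact absurd (h x0 (by simpa [not_lt.mp hn] using hx0)) (not_le.mpr hbx0)
      -- Normalized so that `x ↦ x - a j₀ x • x1` projects onto the kernel of `a j₀`. The induction
      -- hypothesis is applied to the functionals composed with this projection.
      obtain ⟨x1, hx1, hbx1, h1⟩ : ∃ x1, (∀ j ∈ s, a j x1 ≤ 0) ∧ 0 < b x1 ∧ a j₀ x1 = 1 := by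
        refine ⟨(a j₀ x0)⁻¹ • x0, fun j hjs => ?_, ?_, ?_⟩
        · rw [map_smul, smul_eq_mul]
          exact mul_nonpos_of_nonneg_of_nonpos (by positivity) (hx0 j hjs)
        · rw [map_smul, smul_eq_mul]; positivity
        · rw [map_smul, smul_eq_mul]; field_simp
      obtain ⟨w, hw, hb⟩ := ih (fun j => a j - a j x1 • a j₀) (b - b x1 • a j₀) (by
        intro x hx
        have := h (x - a j₀ x • x1) (by
          intro j hjs
          rcases Finset.mem_insert.mp hjs with rfl | hjs
          · simp [h1]
          · have := hx j hjs
            simp at this ⊢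
            linarith)
        simp at this ⊢
        linarith)
      -- The new weight is what evaluation at `x1` dictates. It is nonnegative because `b x1 > 0`
      -- while every `a j x1 ≤ 0`.
      refine ⟨Function.update w j₀ (b x1 - ∑ j ∈ s, w j * a j x1), fun j => ?_, ?_⟩
      · by_cases hjj : j = j₀
        · subst hjj
          simp only [Function.update_self]
          have : ∑ j ∈ s, w j * a j x1 ≤ 0 :=
            Finset.sum_nonpos fun j hjs => mul_nonpos_of_nonneg_of_nonpos (hw j) (hx1 j hjs)
          linarith
        · simp [hjj, hw]
      · rw [Finset.sum_insert hj]
        have e : ∑ j ∈ s, Function.update w j₀ (b x1 - ∑ j ∈ s, w j * a j x1) j • a j =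
            ∑ j ∈ s, w j • a j := by
          refine Finset.sum_congr rfl fun j hjs => ?_
          rw [Function.update_of_ne (ne_of_mem_of_not_mem hjs hj)]
        rw [e]
        ext x
        have hbx := LinearMap.congr_fun hb x
        simp only [LinearMap.sub_apply, LinearMap.smul_apply, smul_eq_mul, LinearMap.sum_apply,
          mul_sub, Finset.sum_sub_distrib] at hbx
        simp only [Function.update_self, LinearMap.add_apply, LinearMap.smul_apply, smul_eq_mul,
          LinearMap.sum_apply, sub_mul, Finset.sum_mul]
        have e2 : ∑ j ∈ s, w j * (a j x1 * a j₀ x) = ∑ j ∈ s, w j * a j x1 * a j₀ x :=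
          Finset.sum_congr rfl fun j _ => by ring
        linarith

theorem mem_cone {ι J : Type*} [Fintype J] {G : Matrix ι J ℝ} {x : ι → ℝ} : x ∈ cone G ↔ ∃ α : J → ℝ, 0 ≤ α ∧ x = G *ᵥ α :=
  Iff.rfl

variable {ι J : Type*} [Fintype ι] [Fintype J]

theorem col_mem_cone {ι J : Type*} [Fintype J] (G : Matrix ι J ℝ) (j : J) : G.col j ∈ cone G := by
  classical
  refine mem_cone.mpr ⟨Pi.single j 1, ?_, by simp⟩
  rw [Pi.le_def]
  intro i
  by_cases h : i = j
  · subst h; simp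
  · simp [h]

theorem dotProduct_nonpos_of_mem_cone {G : Matrix ι J ℝ} {c x : ι → ℝ}
    (hc : ∀ j, G.col j ⬝ᵥ c ≤ 0) (hx : x ∈ cone G) : x ⬝ᵥ c ≤ 0 := by
  obtain ⟨α, hα, rfl⟩ := mem_cone.mp hx
  rw [dotProduct_comm, Matrix.dotProduct_mulVec, dotProduct]
  refine Finset.sum_nonpos fun j _ => mul_nonpos_of_nonpos_of_nonneg ?_ (hα j)
  have := hc j
  rwa [dotProduct_comm] at this

/-- A vector outside a finitely generated cone is separated from it. -/
theorem exists_separating_of_notMem_cone {G : Matrix ι J ℝ} {x : ι → ℝ} (hx : x ∉ cone G) :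
    ∃ c : ι → ℝ, (∀ j, G.col j ⬝ᵥ c ≤ 0) ∧ 0 < x ⬝ᵥ c := by
  classical
  by_contra hcon
  push Not at hcon
  obtain ⟨w, hw, hb⟩ := farkas_functional (V := ι → ℝ) Finset.univ
    (fun j : J => dotProductBilin ℝ ℝ (G.col j)) (dotProductBilin ℝ ℝ x) (by
      intro c hc
      exact hcon c fun j => hc j (Finset.mem_univ _))
  refine hx (mem_cone.mpr ⟨w, hw, ?_⟩)
  ext i
  have := LinearMap.congr_fun hb (Pi.single i 1)
  simp [LinearMap.sum_apply] at this
  rw [this, Matrix.mulVec, dotProduct]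
  exact Finset.sum_congr rfl fun j _ => mul_comm _ _

/-- A vector of the polar of a finitely generated cone which is negative on the generators outside
the lineality space. -/
theorem exists_polar_neg (G : Matrix ι J ℝ) :
    ∃ c : ι → ℝ, (∀ j, G.col j ⬝ᵥ c ≤ 0) ∧ ∀ j, G.col j ∉ (cone G).lineal → G.col j ⬝ᵥ c < 0 := by
  classical
  have key : ∀ j, ∃ c : ι → ℝ, (∀ j, G.col j ⬝ᵥ c ≤ 0) ∧
      (G.col j ∉ (cone G).lineal → G.col j ⬝ᵥ c < 0) := by
    intro j
    by_cases hj : G.col j ∈ (cone G).lineal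
    · exact ⟨0, by simp, fun h => absurd hj h⟩
    · rw [PointedCone.mem_lineal, not_and] at hj
      obtain ⟨c, hc, hcj⟩ := exists_separating_of_notMem_cone (hj (col_mem_cone G j))
      exact ⟨c, hc, fun _ => by simpa using hcj⟩
  choose c hc hcj using key
  -- Summing one separating vector per column keeps all pairings nonpositive and retains each strict
  -- inequality.
  refine ⟨∑ j, c j, fun i => ?_, fun i hi => ?_⟩
  · rw [dotProduct_sum]
    exact Finset.sum_nonpos fun j _ => hc j i
  · rw [dotProduct_sum]
    exact Finset.sum_neg' (fun j _ => hc j i) ⟨i, Finset.mem_univ _, hcj i hi⟩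

theorem dotProduct_eq_zero_of_mem_lineal {G : Matrix ι J ℝ} {c x : ι → ℝ}
    (hc : ∀ j, G.col j ⬝ᵥ c ≤ 0) (hx : x ∈ (cone G).lineal) : x ⬝ᵥ c = 0 := by
  obtain ⟨h1, h2⟩ := PointedCone.mem_lineal.mp hx
  have h3 := dotProduct_nonpos_of_mem_cone hc h1
  have h4 := dotProduct_nonpos_of_mem_cone hc h2
  rw [neg_dotProduct] at h4
  linarith

theorem diffBlock_mulVec {R : Type*} [CommRing R] {q : ℕ} (k l : Fin q) (d : ℕ)
    (w : Unit × Fin d → R) (a : Fin q × Fin d) :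
    (diffBlock R k l d *ᵥ w) a =
      (Pi.single k 1 - Pi.single l 1 : Fin q → R) a.1 * w ((), a.2) := by
  simp [Matrix.mulVec, dotProduct, diffBlock, Fintype.sum_prod_type, Matrix.one_apply]

theorem diffBlock_mulVec_dotProduct {R : Type*} [CommRing R] {q d : ℕ} (k l : Fin q)
    (w : Unit × Fin d → R) (c : Fin q × Fin d → R) :
    (diffBlock R k l d *ᵥ w) ⬝ᵥ c = ∑ j, w ((), j) * (c (k, j) - c (l, j)) := by
  simp only [dotProduct, diffBlock_mulVec, Fintype.sum_prod_type]
  rw [Finset.sum_comm]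
  refine Finset.sum_congr rfl fun j _ => ?_
  simp [sub_mul, Pi.single_apply, Finset.sum_sub_distrib, mul_sub]

theorem mem_ker_diffBlock_transpose {q d : ℕ} (k l : Fin q) (η : Fin q × Fin d → ℝ) :
    η ∈ LinearMap.ker (diffBlock ℝ k l d)ᵀ.mulVecLin ↔ ∀ j, η (k, j) = η (l, j) := by
  classical
  rw [LinearMap.mem_ker, Matrix.mulVecLin_apply]
  have key : ∀ w, ((diffBlock ℝ k l d)ᵀ *ᵥ η) ⬝ᵥ w = ∑ j, w ((), j) * (η (k, j) - η (l, j)) := by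
    intro w
    rw [← diffBlock_mulVec_dotProduct, Matrix.mulVec_transpose, ← Matrix.dotProduct_mulVec,
      dotProduct_comm]
  constructor
  · intro h j
    have := key (Pi.single ((), j) 1)
    rw [h] at this
    simp [Pi.single_apply] at this
    linarith
  · intro h
    ext a
    have := key (Pi.single a 1)
    simpa [h] using this

/-- Duality for cones: a subspace lies in a finitely generated cone iff every polar vector
annihilates it. A functional that is nonpositive on a subspace vanishes there, and separation gives
the converse. -/
theorem isStronglyConn_iff {q d : ℕ} (k l : Fin q) (G : Matrix (Fin q × Fin d) J ℂ) :
    IsStronglyConn k l G ↔ (∀ a b, (G a b).im = 0) ∧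
      ∀ c : Fin q × Fin d → ℝ, (∀ j, (G.map Complex.re).col j ⬝ᵥ c ≤ 0) →
        ∀ j, c (k, j) = c (l, j) := by
  classical
  refine and_congr_right fun _ => ⟨fun h c hc j => ?_, fun h => ?_⟩
  · have hle : ∀ s : ℝ, s * (c (k, j) - c (l, j)) ≤ 0 := by
      intro s
      have h1 := dotProduct_nonpos_of_mem_cone hc
        (h ⟨(Pi.single ((), j) s : Unit × Fin d → ℝ), rfl⟩)
      rw [Matrix.mulVecLin_apply, diffBlock_mulVec_dotProduct] at h1
      simpa [Pi.single_apply] using h1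
    nlinarith [hle (c (k, j) - c (l, j))]
  · rintro _ ⟨w, rfl⟩
    by_contra hn
    obtain ⟨c, hc, hpos⟩ := exists_separating_of_notMem_cone hn
    rw [Matrix.mulVecLin_apply, diffBlock_mulVec_dotProduct] at hpos
    simp [h c hc] at hpos

/-- Inclusion of ranges is inclusion of annihilators. The conjugation makes the pairing Hermitian,
matching the pairings that occur in the modal responses. -/
theorem isConn_iff {q d : ℕ} (k l : Fin q) (G : Matrix (Fin q × Fin d) J ℂ) :
    IsConn k l G ↔ ∀ c : Fin q × Fin d → ℂ, (∀ j, star (G.col j) ⬝ᵥ c = 0) →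
        ∀ j, c (k, j) = c (l, j) := by
  classical
  have hcol : ∀ (c : Fin q × Fin d → ℂ) (j : J),
      star (G.col j) ⬝ᵥ c = star (G.col j ⬝ᵥ star c) := by
    intro c j
    rw [Matrix.star_dotProduct, dotProduct_comm]
  constructor
  · intro h c hc j
    obtain ⟨α, hα⟩ := h ⟨(Pi.single ((), j) 1 : Unit × Fin d → ℂ), rfl⟩
    have h1 : (G *ᵥ α) ⬝ᵥ star c = 0 := by
      rw [dotProduct_comm, Matrix.dotProduct_mulVec]
      have : star c ᵥ* G = 0 := by
        ext j
        have := hc j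
        rw [hcol, star_eq_zero, dotProduct_comm] at this
        exact this
      rw [this, zero_dotProduct]
    rw [Matrix.mulVecLin_apply, Matrix.mulVecLin_apply] at hα
    rw [hα, diffBlock_mulVec_dotProduct] at h1
    simp [Pi.single_apply, sub_eq_zero] at h1
    exact star_injective h1
  · intro h
    rintro _ ⟨w, rfl⟩
    by_contra hn
    obtain ⟨f, hf, hfG⟩ := Submodule.exists_le_ker_of_notMem hn
    set c : Fin q × Fin d → ℂ := fun a => star (f (Pi.single a 1)) with hcdef
    have hfx : ∀ x, f x = x ⬝ᵥ star c := by
      intro x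
      conv_lhs => rw [← Finset.univ_sum_single x, map_sum]
      refine Finset.sum_congr rfl fun a _ => ?_
      have : (Pi.single a (x a) : Fin q × Fin d → ℂ) = x a • Pi.single a 1 := by
        rw [← Pi.single_smul]; simp
      rw [this, map_smul]
      simp [hcdef]
    have hc := h c (by
      intro j
      rw [hcol, ← hfx, star_eq_zero]
      refine hfG ⟨Pi.single j 1, ?_⟩
      simp)
    apply hf
    rw [hfx, Matrix.mulVecLin_apply, diffBlock_mulVec_dotProduct]
    refine Finset.sum_eq_zero fun j _ => ?_
    simp [hc j]

end

/-! ### Asymptotics of nonpositive exponential polynomials. -/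

section

open Filter Topology

theorem tendsto_cesaro_pow {z : ℂ} (hz : ‖z‖ = 1) :
    Tendsto (fun n : ℕ => (n⁻¹ : ℝ) • ∑ j ∈ Finset.range n, z ^ j) atTop
      (𝓝 (if z = 1 then 1 else 0)) := by
  split_ifs with h
  · subst h
    exact (tendsto_const_nhds.congr fun n => (one_pow n).symm).cesaro_smul
  · have hz1 : 0 < ‖z - 1‖ := norm_pos_iff.mpr (sub_ne_zero.mpr h)
    rw [tendsto_zero_iff_norm_tendsto_zero]
    have hb : Tendsto (fun n : ℕ => (n⁻¹ : ℝ) * (2 / ‖z - 1‖)) atTop (𝓝 0) := by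
      simpa using (tendsto_inv_atTop_nhds_zero_nat (𝕜 := ℝ)).mul_const (2 / ‖z - 1‖)
    refine squeeze_zero (fun _ => norm_nonneg _) (fun n => ?_) hb
    rw [norm_smul, geom_sum_eq h, norm_div, Real.norm_of_nonneg (by positivity)]
    gcongr
    calc ‖z ^ n - 1‖ ≤ ‖z ^ n‖ + ‖(1 : ℂ)‖ := norm_sub_le _ _
      _ = 2 := by rw [norm_pow, hz]; norm_num

/-- The means of a sequence asymptotic to a trigonometric polynomial. -/
theorem tendsto_cesaro_trig {K : Type*} [Fintype K] {z a : K → ℂ} (hz : ∀ k, ‖z k‖ = 1)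
    {h : ℕ → ℂ} (hh : Tendsto (fun j => h j - ∑ k, a k * z k ^ j) atTop (𝓝 0))
    {w : ℂ} (hw : ‖w‖ = 1) :
    Tendsto (fun n : ℕ => (n⁻¹ : ℝ) • ∑ j ∈ Finset.range n, h j * w ^ j) atTop
      (𝓝 (∑ k, if z k * w = 1 then a k else 0)) := by
  have h1 : Tendsto (fun j => (h j - ∑ k, a k * z k ^ j) * w ^ j) atTop (𝓝 0) := by
    rw [tendsto_zero_iff_norm_tendsto_zero] at hh ⊢
    simpa [hw] using hh
  have h2 : Tendsto (fun n : ℕ => ∑ k, a k * ((n⁻¹ : ℝ) • ∑ j ∈ Finset.range n, (z k * w) ^ j))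
      atTop (𝓝 (∑ k, a k * (if z k * w = 1 then 1 else 0))) :=
    tendsto_finsetSum _ fun k _ =>
      (tendsto_cesaro_pow (by rw [norm_mul, hz, hw, one_mul])).const_mul _
  have h3 := h1.cesaro_smul.add h2
  simp only [mul_ite, mul_one, mul_zero, zero_add] at h3
  refine h3.congr fun n => ?_
  have : ∑ k, a k * ((n⁻¹ : ℝ) • ∑ j ∈ Finset.range n, (z k * w) ^ j) =
      (n⁻¹ : ℝ) • ∑ j ∈ Finset.range n, (∑ k, a k * z k ^ j) * w ^ j := by
    simp only [mul_smul_comm, ← Finset.smul_sum]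
    congr 1
    simp only [Finset.mul_sum, Finset.sum_mul]
    rw [Finset.sum_comm]
    refine Finset.sum_congr rfl fun j _ => Finset.sum_congr rfl fun k _ => ?_
    rw [mul_pow]; ring
  rw [this, ← smul_add, ← Finset.sum_add_distrib]
  congr 1
  exact Finset.sum_congr rfl fun j _ => by ring

/-- The coefficients of a trigonometric polynomial asymptotic to a nonpositive sequence are bounded
by minus its mean. -/
theorem norm_coeff_le_neg_mean {K : Type*} [Fintype K] {z a : K → ℂ} (hz : ∀ k, ‖z k‖ = 1)
    (hzi : Function.Injective z) {h : ℕ → ℝ} (hneg : ∀ j, h j ≤ 0)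
    (hh : Tendsto (fun j => (h j : ℂ) - ∑ k, a k * z k ^ j) atTop (𝓝 0)) (k : K) :
    ‖a k‖ ≤ -(∑ k, if z k = 1 then a k else 0).re := by
  classical
  have h1 := tendsto_cesaro_trig hz hh (w := 1) (by simp)
  -- The mean of `h j * conj (z k) ^ j` recovers `a k`, since the `z k` are distinct. Its modulus is
  -- at most the mean of `|h j| = -h j`.
  have h2 := tendsto_cesaro_trig hz hh (w := star (z k)) (by rw [norm_star, hz])
  have e : (∑ k', if z k' * star (z k) = 1 then a k' else 0) = a k := by
    rw [Finset.sum_eq_single k]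
    · rw [if_pos]
      have := Complex.mul_conj (z k)
      rw [Complex.normSq_eq_norm_sq, hz] at this
      simpa using this
    · intro b _ hb
      rw [if_neg]
      intro hbk
      apply hb
      apply hzi
      have h3 := Complex.mul_conj (z k)
      rw [Complex.normSq_eq_norm_sq, hz] at h3
      have h4 : star (z k) ≠ 0 := by
        intro h0; rw [h0, mul_zero] at hbk; exact zero_ne_one hbk
      apply mul_right_cancel₀ h4
      rw [hbk]
      simpa using h3.symm
    · simp
  rw [e] at h2
  simp only [mul_one, one_pow] at h1
  refine le_of_tendsto_of_tendsto h2.norm ((Complex.continuous_re.tendsto _).comp h1).neg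
    (Eventually.of_forall fun n => ?_)
  simp only [Function.comp]
  rw [norm_smul, Real.norm_of_nonneg (by positivity), Complex.real_smul, Complex.re_ofReal_mul,
    ← mul_neg]
  gcongr
  refine (norm_sum_le _ _).trans ?_
  rw [Complex.re_sum, ← Finset.sum_neg_distrib]
  refine Finset.sum_le_sum fun j _ => ?_
  rw [norm_mul, norm_pow, norm_star, hz, one_pow, mul_one, Complex.norm_real, Complex.ofReal_re,
    Real.norm_of_nonpos (hneg j)]

theorem norm_coeff_le_neg_mean_of_real {K : Type*} [Fintype K] {ω : K → ℝ} {a : K → ℂ}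
    (hω : Function.Injective ω) {h : ℝ → ℝ} (hneg : ∀ t, 0 ≤ t → h t ≤ 0)
    (hh : Tendsto (fun t : ℝ => (h t : ℂ) - ∑ k, a k * Complex.exp (ω k * t * Complex.I)) atTop
      (𝓝 0)) (k : K) :
    ‖a k‖ ≤ -(∑ k, if ω k = 0 then a k else 0).re := by
  -- Sampling step: it makes `|ω k * δ| ≤ 1 < π`, so distinct frequencies remain distinct on the
  -- unit circle.
  set δ : ℝ := (1 + ∑ k, |ω k|)⁻¹ with hδ
  have hs : 0 ≤ ∑ k, |ω k| := Finset.sum_nonneg fun k _ => abs_nonneg _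
  have hδ0 : 0 < δ := by positivity
  have hb : ∀ k, |ω k * δ| ≤ 1 := by
    intro k
    have h1 : |ω k| ≤ ∑ k, |ω k| :=
      Finset.single_le_sum (f := fun k => |ω k|) (fun k _ => abs_nonneg _) (Finset.mem_univ k)
    rw [abs_mul, abs_of_pos hδ0, hδ, ← div_eq_mul_inv, div_le_one (by positivity)]
    linarith
  have hexp : ∀ x y : ℝ, |x| ≤ 1 → |y| ≤ 1 →
      Complex.exp (x * Complex.I) = Complex.exp (y * Complex.I) → x = y := by
    intro x y hx hy he
    have hpi := Real.pi_gt_three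
    rw [abs_le] at hx hy
    have := Complex.exp_inj_of_neg_pi_lt_of_le_pi (by simp; linarith) (by simp; linarith)
      (by simp; linarith) (by simp; linarith) he
    simpa using this
  have hz : ∀ k, ‖Complex.exp ((ω k * δ : ℝ) * Complex.I)‖ = 1 := fun k =>
    Complex.norm_exp_ofReal_mul_I _
  have hzi : Function.Injective fun k => Complex.exp ((ω k * δ : ℝ) * Complex.I) := by
    intro k k' hkk
    exact hω (mul_right_cancel₀ hδ0.ne' (hexp _ _ (hb k) (hb k') hkk))
  have hseq : Tendsto (fun j : ℕ => (j : ℝ) * δ) atTop atTop :=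
    tendsto_natCast_atTop_atTop.atTop_mul_const hδ0
  have := norm_coeff_le_neg_mean hz hzi (a := a) (h := fun j => h (j * δ))
    (fun j => hneg _ (by positivity)) ((hh.comp hseq).congr fun j => by
      simp only [Function.comp]
      congr 1
      refine Finset.sum_congr rfl fun k _ => ?_
      rw [← Complex.exp_nat_mul]
      congr 2
      push_cast; ring) k
  convert this using 6 with k'
  constructor
  · intro h0; simp [h0]
  · intro h1
    have := hexp (ω k' * δ) 0 (hb k') (by simp) (by simpa using h1)
    rcases mul_eq_zero.mp this with h2 | h2
    · exact h2
    · exact absurd h2 hδ0.ne'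

theorem tendsto_eval_div_pow (P : Polynomial ℂ) {D : ℕ} (hD : P.natDegree ≤ D) :
    Tendsto (fun t : ℝ => P.eval (t : ℂ) / (t : ℂ) ^ D) atTop (𝓝 (P.coeff D)) := by
  have hterm : ∀ r ∈ Finset.range (D + 1),
      Tendsto (fun t : ℝ => P.coeff r * ((t : ℂ) ^ r / (t : ℂ) ^ D)) atTop
        (𝓝 (P.coeff r * if r = D then 1 else 0)) := by
    intro r hr
    refine Tendsto.const_mul _ ?_
    split_ifs with h
    · subst h
      refine tendsto_const_nhds.congr' ?_
      filter_upwards [eventually_gt_atTop 0] with t ht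
      rw [div_self (pow_ne_zero _ (by exact_mod_cast ht.ne'))]
    · have hlt : r < D := by simp at hr; omega
      have := tendsto_pow_div_pow_atTop_zero (𝕜 := ℝ) hlt
      have h2 := (Complex.continuous_ofReal.tendsto 0).comp this
      simpa [Function.comp_def] using h2
  have := tendsto_finsetSum _ hterm
  simp only [mul_ite, mul_one, mul_zero, Finset.sum_ite_eq', Finset.mem_range, Nat.lt_succ_self,
    if_true] at this
  refine this.congr fun t => ?_
  rw [Polynomial.eval_eq_sum_range' (Nat.lt_succ_of_le hD), Finset.sum_div]
  exact Finset.sum_congr rfl fun r _ => by ring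

theorem tendsto_exp_mul_eval (P : Polynomial ℂ) {x : ℂ} (hx : x.re < 0) :
    Tendsto (fun t : ℝ => Complex.exp (x * t) * P.eval (t : ℂ)) atTop (𝓝 0) := by
  have hterm : ∀ r ∈ Finset.range (P.natDegree + 1),
      Tendsto (fun t : ℝ => P.coeff r * (Complex.exp (x * t) * (t : ℂ) ^ r)) atTop
        (𝓝 (P.coeff r * 0)) := by
    intro r _
    refine Tendsto.const_mul _ ?_
    rw [tendsto_zero_iff_norm_tendsto_zero]
    have h1 := (isLittleO_pow_exp_pos_mul_atTop r (b := -x.re) (by linarith)).tendsto_div_nhds_zero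
    have h2 := h1.norm
    rw [norm_zero] at h2
    refine h2.congr fun t => ?_
    rw [norm_div, norm_mul, Complex.norm_exp, norm_pow, norm_pow, Complex.norm_real,
      Real.norm_of_nonneg (Real.exp_pos _).le, neg_mul, Real.exp_neg]
    simp [mul_comm]
  have := tendsto_finsetSum _ hterm
  simp only [mul_zero, Finset.sum_const_zero] at this
  refine this.congr fun t => ?_
  rw [Polynomial.eval_eq_sum_range, Finset.mul_sum]
  exact Finset.sum_congr rfl fun r _ => by ring

/-- In a nonpositive exponential polynomial whose exponents have real part at most `ρ`, the
coefficients of top degree at real part `ρ` are dominated by that of the real exponent `ρ`. -/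
theorem norm_coeff_le_neg_real_coeff {K : Type*} [Fintype K] {μ : K → ℂ}
    (hμ : Function.Injective μ) {P : K → Polynomial ℂ} {f : ℝ → ℝ} (hneg : ∀ t, 0 ≤ t → f t ≤ 0)
    (hf : ∀ t : ℝ, (f t : ℂ) = ∑ k, Complex.exp (μ k * t) * (P k).eval (t : ℂ)) {ρ : ℝ}
    (hgt : ∀ k, ρ < (μ k).re → P k = 0) {D : ℕ} (hD : ∀ k, (μ k).re = ρ → (P k).natDegree ≤ D)
    {k : K} (hk : (μ k).re = ρ) :
    ‖(P k).coeff D‖ ≤ -(∑ k, if μ k = ρ then (P k).coeff D else 0).re := by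
  classical
  -- Dividing by `e^{ρt} t^D` preserves the sign and leaves, up to a vanishing error, the
  -- trigonometric polynomial of the degree-`D` coefficients at real part `ρ`.
  have key := norm_coeff_le_neg_mean_of_real (K := {k // (μ k).re = ρ})
    (ω := fun k => (μ k.1).im) (a := fun k => (P k.1).coeff D)
    (fun x y hxy => Subtype.ext (hμ (Complex.ext (x.2.trans y.2.symm) hxy)))
    (h := fun t => f t * Real.exp (-(ρ * t)) / t ^ D)
    (fun t ht => div_nonpos_of_nonpos_of_nonneg
      (mul_nonpos_of_nonpos_of_nonneg (hneg t ht) (Real.exp_pos _).le) (by positivity)) ?_ ⟨k, hk⟩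
  · convert key using 3
    rw [← Finset.sum_subtype (Finset.univ.filter fun k => (μ k).re = ρ) (by simp)
      (fun k => if (μ k).im = 0 then (P k).coeff D else 0), Finset.sum_filter]
    refine Finset.sum_congr rfl fun k _ => ?_
    by_cases h1 : (μ k).re = ρ <;> by_cases h2 : (μ k).im = 0 <;>
      simp [h1, h2, Complex.ext_iff]
  · have hterm : ∀ k ∈ Finset.univ, Tendsto (fun t : ℝ =>
        Complex.exp ((μ k - ρ) * t) * (P k).eval (t : ℂ) / (t : ℂ) ^ D -
          if (μ k).re = ρ then (P k).coeff D * Complex.exp ((μ k).im * t * Complex.I) else 0)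
        atTop (𝓝 0) := by
      intro k _
      rcases lt_trichotomy (μ k).re ρ with h | h | h
      · simp only [h.ne, if_false, sub_zero]
        have h1 := tendsto_exp_mul_eval (P k) (x := μ k - ρ) (by simp; linarith)
        rw [tendsto_zero_iff_norm_tendsto_zero] at h1 ⊢
        refine squeeze_zero' (Eventually.of_forall fun _ => norm_nonneg _) ?_ h1
        filter_upwards [eventually_ge_atTop 1] with t ht
        rw [norm_div]
        refine div_le_self (norm_nonneg _) ?_
        rw [norm_pow, Complex.norm_real, Real.norm_of_nonneg (by linarith)]
        exact one_le_pow₀ ht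
      · simp only [h, if_true]
        have h1 := tendsto_eval_div_pow (P k) (hD k h)
        have h2 := tendsto_sub_nhds_zero_iff.mpr h1
        rw [tendsto_zero_iff_norm_tendsto_zero] at h2 ⊢
        refine h2.congr fun t => ?_
        have e : (μ k - ρ) * t = ((μ k).im * t : ℝ) * Complex.I := by
          apply Complex.ext <;> simp [h]
        have e' : (μ k).im * t * Complex.I = ((μ k).im * t : ℝ) * Complex.I := by push_cast; ring
        rw [e, e', mul_div_assoc, mul_comm ((P k).coeff D), ← mul_sub, norm_mul,
          Complex.norm_exp_ofReal_mul_I, one_mul]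
      · simp [h.ne', hgt k h]
    have := tendsto_finsetSum _ hterm
    simp only [Finset.sum_const_zero] at this
    refine this.congr fun t => ?_
    rw [Finset.sum_sub_distrib]
    congr 1
    · push_cast
      rw [hf, Finset.sum_mul, Finset.sum_div]
      refine Finset.sum_congr rfl fun k _ => ?_
      rw [sub_mul, sub_eq_add_neg, Complex.exp_add]
      ring
    · rw [← Finset.sum_subtype (Finset.univ.filter fun k => (μ k).re = ρ) (by simp)
        (fun k => (P k).coeff D * Complex.exp ((μ k).im * t * Complex.I)), Finset.sum_filter]

/-- Without the real exponent `ρ`, the terms of real part `ρ` vanish. -/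
theorem eq_zero_of_real_eq_zero {K : Type*} [Fintype K] {μ : K → ℂ}
    (hμ : Function.Injective μ) {P : K → Polynomial ℂ} {f : ℝ → ℝ} (hneg : ∀ t, 0 ≤ t → f t ≤ 0)
    (hf : ∀ t : ℝ, (f t : ℂ) = ∑ k, Complex.exp (μ k * t) * (P k).eval (t : ℂ)) {ρ : ℝ}
    (hgt : ∀ k, ρ < (μ k).re → P k = 0) (hreal : ∀ k, μ k = ρ → P k = 0)
    {k : K} (hk : (μ k).re = ρ) : P k = 0 := by
  classical
  -- At the maximal degree the mean is zero, so all coefficients of that degree vanish, including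
  -- the leading one of `P k₀`. Hence `P k₀ = 0` and the maximal degree is `0`, where the
  -- coefficients vanish too.
  obtain ⟨k₀, hk₀, hmax⟩ := Finset.exists_max_image
    (Finset.univ.filter fun k => (μ k).re = ρ) (fun k => (P k).natDegree) ⟨k, by simpa using hk⟩
  have hz : ∀ k, (μ k).re = ρ → (P k).coeff (P k₀).natDegree = 0 := by
    intro k hk
    have := norm_coeff_le_neg_real_coeff hμ hneg hf hgt (D := (P k₀).natDegree)
      (fun k hk => hmax k (by simpa using hk)) hk
    rw [Finset.sum_eq_zero] at this
    · simpa using this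
    · intro j _
      split_ifs with h
      · rw [hreal j h, Polynomial.coeff_zero]
      · rfl
  have h0 : P k₀ = 0 := Polynomial.leadingCoeff_eq_zero.mp (hz k₀ (by simpa using hk₀))
  have h1 := hmax k (by simpa using hk)
  have h2 := hz k hk
  rw [h0, Polynomial.natDegree_zero] at h1 h2
  rw [Polynomial.eq_C_of_natDegree_le_zero h1, h2, Polynomial.C_0]

/-- If the nonreal exponents of real part `ρ` have constant coefficients, the leading coefficient
at the real exponent `ρ` is nonpositive. -/
theorem leadingCoeff_real_nonpos {K : Type*} [Fintype K] {μ : K → ℂ}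
    (hμ : Function.Injective μ) {P : K → Polynomial ℂ} {f : ℝ → ℝ} (hneg : ∀ t, 0 ≤ t → f t ≤ 0)
    (hf : ∀ t : ℝ, (f t : ℂ) = ∑ k, Complex.exp (μ k * t) * (P k).eval (t : ℂ)) {ρ : ℝ}
    (hgt : ∀ k, ρ < (μ k).re → P k = 0)
    (hconst : ∀ k, (μ k).re = ρ → (μ k).im ≠ 0 → (P k).natDegree = 0)
    {k : K} (hk : μ k = ρ) : (P k).leadingCoeff.re ≤ 0 := by
  classical
  have hre : (μ k).re = ρ := by rw [hk, Complex.ofReal_re]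
  -- The degree of the real term bounds the others, which are constant. The estimate then reads `‖a‖
  -- ≤ -Re a` for its leading coefficient `a`.
  have := norm_coeff_le_neg_real_coeff hμ hneg hf hgt (D := (P k).natDegree) (fun j hj => by
    by_cases h : (μ j).im = 0
    · have : j = k := hμ (by rw [hk]; exact Complex.ext (by simpa using hj) (by simpa using h))
      rw [this]
    · rw [hconst j hj h]; exact Nat.zero_le _) hre
  rw [Finset.sum_eq_single k (fun b _ hb => if_neg fun h => hb (hμ (h.trans hk.symm))) (by simp),
    if_pos hk] at this
  have h2 := norm_nonneg ((P k).coeff (P k).natDegree)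
  change ((P k).coeff (P k).natDegree).re ≤ 0
  linarith

end

section

open NormedSpace

/-! ### Matrix exponentials -/

section Exponential

variable {ι : Type*} [Fintype ι] [DecidableEq ι]

open scoped Matrix.Norms.Operator in
theorem hasSum_exp_mulVec (Y : Matrix ι ι ℂ) (v : ι → ℂ) :
    HasSum (fun r : ℕ => ((r.factorial : ℂ)⁻¹ • Y ^ r) *ᵥ v) (exp Y *ᵥ v) := by
  have h := NormedSpace.exp_series_hasSum_exp' (𝕂 := ℂ) Y
  have hc : Continuous fun M : Matrix ι ι ℂ => M *ᵥ v := by fun_prop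
  exact h.map (AddMonoidHom.mk' (fun M : Matrix ι ι ℂ => M *ᵥ v) fun M N => Matrix.add_mulVec M N v)
    hc

open scoped Matrix.Norms.Operator in
theorem exp_map_ofReal (Y : Matrix ι ι ℝ) :
    (exp Y).map Complex.ofReal = exp (Y.map Complex.ofReal) := by
  exact NormedSpace.map_exp (Complex.ofRealHom.mapMatrix : Matrix ι ι ℝ →+* Matrix ι ι ℂ)
    (Continuous.matrix_map continuous_id Complex.continuous_ofReal) Y

theorem exp_smul_one (z : ℂ) : exp (z • (1 : Matrix ι ι ℂ)) = Complex.exp z • 1 := by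
  rw [Matrix.smul_one_eq_diagonal, Matrix.exp_diagonal, Matrix.smul_one_eq_diagonal]
  congr 1
  ext i
  rw [Pi.coe_exp, Complex.exp_eq_exp_ℂ]

/-- The exponential on a generalized eigenvector. -/
theorem exp_smul_mulVec_of_pow_eq_zero (X : Matrix ι ι ℂ) (μ : ℂ) {d : ℕ} {v : ι → ℂ}
    (hv : (X - μ • 1) ^ d *ᵥ v = 0) (t : ℂ) :
    exp (t • X) *ᵥ v = Complex.exp (μ * t) •
      ∑ r ∈ Finset.range d, (t ^ r / r.factorial) • ((X - μ • 1) ^ r *ᵥ v) := by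
  -- The scalar part gives the exponential factor. The series of the commuting remainder stops at
  -- `d` when applied to `v`.
  have hsplit : t • X = (μ * t) • (1 : Matrix ι ι ℂ) + t • (X - μ • 1) := by
    rw [smul_sub, smul_smul, mul_comm μ t]; abel
  have hcomm : Commute ((μ * t) • (1 : Matrix ι ι ℂ)) (t • (X - μ • 1)) :=
    (Commute.one_left _).smul_left _
  rw [hsplit, Matrix.exp_add_of_commute _ _ hcomm, exp_smul_one, smul_mul_assoc, one_mul,
    Matrix.smul_mulVec]
  congr 1
  refine (hasSum_exp_mulVec (t • (X - μ • 1)) v).unique ?_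
  have h := hasSum_sum_of_ne_finset_zero (L := .unconditional ℕ)
    (f := fun r : ℕ => ((r.factorial : ℂ)⁻¹ • (t • (X - μ • 1)) ^ r) *ᵥ v)
    (s := Finset.range d) (by
      intro r hr
      have hr : d ≤ r := by simpa using hr
      obtain ⟨e, rfl⟩ := Nat.exists_eq_add_of_le hr
      rw [Matrix.smul_mulVec, smul_pow, Matrix.smul_mulVec, add_comm d e, pow_add (X - μ • 1) e d,
        ← Matrix.mulVec_mulVec, hv]
      simp)
  convert h using 1
  refine Finset.sum_congr rfl fun r _ => ?_
  rw [smul_pow, smul_smul, Matrix.smul_mulVec]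
  congr 1
  rw [div_eq_inv_mul]

end Exponential

/-! ### Block diagonal matrices with equal blocks -/

/-- The matrix `I_q ⊗ M`. -/
def blk {R : Type*} [CommRing R] {m n : ℕ} (q : ℕ) (M : Matrix (Fin m) (Fin n) R) :
    Matrix (Fin q × Fin m) (Fin q × Fin n) R :=
  (1 : Matrix (Fin q) (Fin q) R) ⊗ₖ M

section Blk

variable {R : Type*} [CommRing R] {m n s q : ℕ}

theorem blk_mulVec_apply (M : Matrix (Fin m) (Fin n) R) (x : Fin q × Fin n → R)
    (a : Fin q × Fin m) : (blk q M *ᵥ x) a = (M *ᵥ fun j => x (a.1, j)) a.2 := by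
  simp [blk, Matrix.mulVec, dotProduct, Fintype.sum_prod_type, Matrix.one_apply]

theorem blk_mul (M : Matrix (Fin m) (Fin n) R) (N : Matrix (Fin n) (Fin s) R) :
    blk q (M * N) = blk q M * blk q N := by
  rw [blk, blk, blk, ← Matrix.mul_kronecker_mul, one_mul]

theorem blk_one : blk q (1 : Matrix (Fin n) (Fin n) R) = 1 := Matrix.one_kronecker_one

theorem blk_pow (M : Matrix (Fin n) (Fin n) R) (r : ℕ) : blk q (M ^ r) = blk q M ^ r := by
  induction r with
  | zero => rw [pow_zero, pow_zero, blk_one]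
  | succ r ih => rw [pow_succ, pow_succ, blk_mul, ih]

theorem blk_sub (M N : Matrix (Fin m) (Fin n) R) : blk q (M - N) = blk q M - blk q N := by
  ext a b; simp [blk, mul_sub]

theorem blk_zero : blk q (0 : Matrix (Fin m) (Fin n) R) = 0 := by
  ext a b; simp [blk]

theorem blk_smul (c : R) (M : Matrix (Fin m) (Fin n) R) : blk q (c • M) = c • blk q M :=
  Matrix.kronecker_smul _ _ _

theorem blk_sum {ι : Type*} (s : Finset ι) (M : ι → Matrix (Fin m) (Fin n) R) :
    blk q (∑ i ∈ s, M i) = ∑ i ∈ s, blk q (M i) := by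
  ext a b
  simp [blk, Matrix.sum_apply, Finset.mul_sum]

theorem blk_transpose (M : Matrix (Fin m) (Fin n) R) : (blk q M)ᵀ = blk q Mᵀ := by
  ext a b; simp [blk, Matrix.one_apply, eq_comm]

theorem blk_conjTranspose (M : Matrix (Fin m) (Fin n) ℂ) : (blk q M)ᴴ = blk q Mᴴ := by
  rw [blk, blk, Matrix.conjTranspose_kronecker, Matrix.conjTranspose_one]

theorem blk_map_ofReal (M : Matrix (Fin m) (Fin n) ℝ) :
    (blk q M).map Complex.ofReal = blk q (M.map Complex.ofReal) := by
  ext a b; simp [blk, Matrix.one_apply, apply_ite Complex.ofReal]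

end Blk

/-! ### Responses -/

/-- The stack of `B_{1σ}, …, B_{qσ}`. -/
def inputVec {n q p : ℕ} (B : Fin q → Fin p → Fin n → ℝ) (σ : Fin p) : Fin q × Fin n → ℝ :=
  fun a => B a.1 σ a.2

/-- The pairing of `η` with the impulse response to the input `σ`. -/
def realResp {n q p : ℕ} (A : Matrix (Fin n) (Fin n) ℝ) (B : Fin q → Fin p → Fin n → ℝ)
    (σ : Fin p) (η : Fin q × Fin n → ℝ) (t : ℝ) : ℝ :=
  (exp (t • bigA q A) *ᵥ inputVec B σ) ⬝ᵥ η

/-- The pairing of a complex vector with the impulse response to the input `σ`. -/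
def resp {n q p : ℕ} (A : Matrix (Fin n) (Fin n) ℝ) (B : Fin q → Fin p → Fin n → ℝ)
    (σ : Fin p) (v : Fin q × Fin n → ℂ) (t : ℝ) : ℂ :=
  (Complex.ofReal ∘ inputVec B σ) ⬝ᵥ (exp ((t : ℂ) • blk q (adj A)) *ᵥ v)

theorem adj_eq {n : ℕ} (A : Matrix (Fin n) (Fin n) ℝ) : adj A = Aᵀ.map Complex.ofReal := by
  ext a b; simp [adj]

section Resp

variable {n q p : ℕ} (A : Matrix (Fin n) (Fin n) ℝ) (B : Fin q → Fin p → Fin n → ℝ) (σ : Fin p)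

theorem resp_ofReal (η : Fin q × Fin n → ℝ) (t : ℝ) :
    resp A B σ (Complex.ofReal ∘ η) t = realResp A B σ η t := by
  have e : (t : ℂ) • blk q (adj A) = ((t • bigA q A)ᵀ).map Complex.ofReal := by
    rw [adj_eq, ← blk_map_ofReal, ← blk_transpose]
    ext a b
    simp [bigA, blk]
  rw [resp, e, ← exp_map_ofReal, Matrix.exp_transpose, realResp]
  have e2 : ((exp (t • bigA q A))ᵀ.map Complex.ofReal) *ᵥ (Complex.ofReal ∘ η) =
      Complex.ofReal ∘ ((exp (t • bigA q A))ᵀ *ᵥ η) := by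
    ext a
    simp [Matrix.mulVec, dotProduct]
  rw [e2, Matrix.mulVec_transpose, dotProduct_comm (exp (t • bigA q A) *ᵥ inputVec B σ),
    Matrix.dotProduct_mulVec, dotProduct_comm]
  simp [dotProduct]

theorem resp_add (v w : Fin q × Fin n → ℂ) (t : ℝ) :
    resp A B σ (v + w) t = resp A B σ v t + resp A B σ w t := by
  simp [resp, Matrix.mulVec_add]

theorem resp_smul (c : ℂ) (v : Fin q × Fin n → ℂ) (t : ℝ) :
    resp A B σ (c • v) t = c * resp A B σ v t := by
  simp [resp, Matrix.mulVec_smul]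

theorem resp_sum {K : Type*} (s : Finset K) (v : K → Fin q × Fin n → ℂ) (t : ℝ) :
    resp A B σ (∑ k ∈ s, v k) t = ∑ k ∈ s, resp A B σ (v k) t := by
  simp [resp, Matrix.mulVec_sum, dotProduct_sum]

theorem realResp_add (v w : Fin q × Fin n → ℝ) (t : ℝ) :
    realResp A B σ (v + w) t = realResp A B σ v t + realResp A B σ w t := by
  simp [realResp]

theorem realResp_smul (c : ℝ) (v : Fin q × Fin n → ℝ) (t : ℝ) :
    realResp A B σ (c • v) t = c * realResp A B σ v t := by
  simp [realResp]

theorem resp_eq (v : Fin q × Fin n → ℂ) (t : ℝ) :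
    resp A B σ v t = realResp A B σ (fun a => (v a).re) t +
      Complex.I * realResp A B σ (fun a => (v a).im) t := by
  rw [← resp_ofReal, ← resp_ofReal, ← resp_smul, ← resp_add]
  congr 1
  ext a
  simp [mul_comm Complex.I, Complex.re_add_im]

end Resp

/-! ### Polynomials with prescribed derivatives at the origin -/

/-- The polynomial `∑_{r<d} g_r X^r / r!`. -/
def expPoly {𝕜 : Type*} [Field 𝕜] (d : ℕ) (g : ℕ → 𝕜) : Polynomial 𝕜 :=
  ∑ r ∈ Finset.range d, Polynomial.monomial r (g r / r.factorial)

section ExpPoly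

variable {𝕜 : Type*} [Field 𝕜]

theorem expPoly_eval (d : ℕ) (g : ℕ → 𝕜) (t : 𝕜) :
    (expPoly d g).eval t = ∑ r ∈ Finset.range d, t ^ r / r.factorial * g r := by
  rw [expPoly, Polynomial.eval_finsetSum]
  refine Finset.sum_congr rfl fun r _ => ?_
  rw [Polynomial.eval_monomial]; ring

theorem expPoly_coeff (d : ℕ) (g : ℕ → 𝕜) (r : ℕ) :
    (expPoly d g).coeff r = if r < d then g r / r.factorial else 0 := by
  simp [expPoly, Polynomial.coeff_monomial]

theorem expPoly_eq_zero_iff [CharZero 𝕜] (d : ℕ) (g : ℕ → 𝕜) :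
    expPoly d g = 0 ↔ ∀ r < d, g r = 0 := by
  constructor
  · intro h r hr
    have := expPoly_coeff d g r
    rw [h, Polynomial.coeff_zero, if_pos hr, eq_comm, div_eq_zero_iff] at this
    exact this.resolve_right (by exact_mod_cast r.factorial_ne_zero)
  · intro h
    ext r
    rw [expPoly_coeff, Polynomial.coeff_zero]
    split_ifs with hr
    · rw [h r hr, zero_div]
    · rfl

/-- Differentiation shifts the coefficient sequence. The vanishing of `g` from `d` on is needed
because the shifted sum, still of length `d`, would otherwise contain `g d`. -/
theorem expPoly_derivative [CharZero 𝕜] (d : ℕ) (g : ℕ → 𝕜) (hg : ∀ r, d ≤ r → g r = 0) :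
    Polynomial.derivative (expPoly d g) = expPoly d fun r => g (r + 1) := by
  ext r
  rw [Polynomial.coeff_derivative, expPoly_coeff, expPoly_coeff]
  have hr : ((r : 𝕜) + 1) ≠ 0 := by exact_mod_cast r.succ_ne_zero
  have hf : (r.factorial : 𝕜) ≠ 0 := by exact_mod_cast r.factorial_ne_zero
  by_cases h1 : r + 1 < d
  · rw [if_pos h1, if_pos (by omega), Nat.factorial_succ]
    push_cast
    field_simp
  · rw [if_neg h1, zero_mul]
    split_ifs
    · rw [hg (r + 1) (by omega), zero_div]
    · rfl

end ExpPoly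

theorem leadingCoeff_derivative_nonpos {P : Polynomial ℝ} (hP : P.leadingCoeff ≤ 0) :
    (Polynomial.derivative P).leadingCoeff ≤ 0 := by
  by_cases h : P.natDegree = 0
  · rw [Polynomial.derivative_of_natDegree_zero h, Polynomial.leadingCoeff_zero]
  · rw [Polynomial.leadingCoeff, Polynomial.natDegree_derivative, Polynomial.coeff_derivative]
    have : P.natDegree - 1 + 1 = P.natDegree := by omega
    rw [this]
    exact mul_nonpos_of_nonpos_of_nonneg hP (by positivity)

open Filter in
theorem eventually_eval_nonpos {P : Polynomial ℝ} (hP : P.leadingCoeff ≤ 0) :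
    ∀ᶠ t in atTop, P.eval t ≤ 0 := by
  by_cases h : 0 < P.degree
  · exact (P.tendsto_atBot_of_leadingCoeff_nonpos h hP).eventually_le_atBot 0
  · have h2 := Polynomial.eq_C_of_degree_le_zero (not_lt.mp h)
    rw [h2, Polynomial.leadingCoeff_C] at hP
    refine Eventually.of_forall fun t => ?_
    rw [h2, Polynomial.eval_C]
    exact hP

open Filter in
/-- If the leading coefficient is nonpositive, so are all derivatives, eventually. -/
theorem eventually_expPoly_shift_nonpos {d : ℕ} {g : ℕ → ℝ} (hg : ∀ r, d ≤ r → g r = 0)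
    (hlc : (expPoly d g).leadingCoeff ≤ 0) (r : ℕ) :
    ∀ᶠ t in atTop, (expPoly d fun s => g (s + r)).eval t ≤ 0 := by
  refine eventually_eval_nonpos ?_
  induction r with
  | zero => simpa using hlc
  | succ r ih =>
    have := leadingCoeff_derivative_nonpos ih
    rw [expPoly_derivative d _ fun s hs => hg _ (by omega)] at this
    convert this using 4
    congr 1; omega

end

section

open NormedSpace

/-! ### The polar of the reachable set -/

section Polar

variable {n q p : ℕ} (A : Matrix (Fin n) (Fin n) ℝ) (B : Fin q → Fin p → Fin n → ℝ)

open scoped Matrix.Norms.Operator in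
theorem continuous_exp_smul {ι : Type*} [Fintype ι] [DecidableEq ι] (X : Matrix ι ι ℝ) :
    Continuous fun t : ℝ => exp (t • X) :=
  NormedSpace.exp_continuous.comp (continuous_id.smul continuous_const)

theorem continuous_realResp (σ : Fin p) (η : Fin q × Fin n → ℝ) :
    Continuous (realResp A B σ η) := by
  have h := continuous_exp_smul (bigA q A)
  unfold realResp
  fun_prop

theorem bigB_mulVec (w : Fin p → ℝ) : bigB B *ᵥ w = ∑ σ, w σ • inputVec B σ := by
  ext a
  simp [bigB, inputVec, Matrix.mulVec, dotProduct, mul_comm]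

theorem integrand_dotProduct (w : Fin p → ℝ) (η : Fin q × Fin n → ℝ) (t : ℝ) :
    (exp (t • bigA q A) *ᵥ (bigB B *ᵥ w)) ⬝ᵥ η = ∑ σ, w σ * realResp A B σ η t := by
  rw [bigB_mulVec, Matrix.mulVec_sum, sum_dotProduct]
  refine Finset.sum_congr rfl fun σ _ => ?_
  rw [Matrix.mulVec_smul, smul_dotProduct, realResp, smul_eq_mul]

theorem intervalIntegral_dotProduct {ι : Type*} [Fintype ι] (η : ι → ℝ) {F : ℝ → ι → ℝ} {a b : ℝ}
    (hF : IntervalIntegrable F volume a b) :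
    (∫ t in a..b, F t) ⬝ᵥ η = ∫ t in a..b, F t ⬝ᵥ η := by
  let L : (ι → ℝ) →L[ℝ] ℝ :=
    LinearMap.toContinuousLinearMap ((dotProductBilin ℝ ℝ).flip η)
  exact (L.intervalIntegral_comp_comm hF).symm

/-- The polar of the reachable set consists of the vectors with nonpositive responses. -/
theorem mem_polar_posReach_iff (η : Fin q × Fin n → ℝ) :
    η ∈ polar (posReach A B) ↔ ∀ σ, ∀ t, 0 ≤ t → realResp A B σ η t ≤ 0 := by
  constructor
  · intro h σ t ht
    by_contra hpos
    push Not at hpos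
    set f := realResp A B σ η with hf
    have hfc : Continuous f := continuous_realResp A B σ η
    -- Feeding the positive part of the time-reversed response pairs with `η` to `∫ max(f,0) f`. The
    -- horizon `t + 1` is positive even for `t = 0`, and the integrand is positive at `s = 1`, where
    -- the response is `f t`.
    set u : ℝ → Fin p → ℝ := fun s => max (f (t + 1 - s)) 0 • Pi.single σ 1 with hu
    have huc : Continuous u := by fun_prop
    have hFc : Continuous fun s => exp ((t + 1 - s) • bigA q A) *ᵥ (bigB B *ᵥ u s) := by
      have h := (continuous_exp_smul (bigA q A)).comp
        (continuous_const.sub continuous_id : Continuous fun s : ℝ => t + 1 - s)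
      simp only [Function.comp_def] at h
      fun_prop
    have hmem := h _ ⟨t + 1, by linarith, u, huc.continuousOn.integrableOn_Icc, fun s _ => by
      simp only [hu]
      refine smul_nonneg (le_max_right _ _) ?_
      rw [Pi.le_def]
      intro i
      by_cases hi : i = σ
      · subst hi; simp
      · simp [hi], rfl⟩
    rw [intervalIntegral_dotProduct η (hFc.intervalIntegrable _ _)] at hmem
    have e : ∀ s, (exp ((t + 1 - s) • bigA q A) *ᵥ (bigB B *ᵥ u s)) ⬝ᵥ η =
        max (f (t + 1 - s)) 0 * f (t + 1 - s) := by
      intro s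
      rw [integrand_dotProduct, Finset.sum_eq_single σ]
      · simp [hu, hf]
      · intro b _ hb; simp [hu, hb]
      · simp
    simp only [e] at hmem
    refine absurd hmem (not_le.mpr ?_)
    refine intervalIntegral.integral_pos (by linarith) (by fun_prop) (fun s _ => ?_)
      ⟨1, ⟨zero_le_one, by linarith⟩, ?_⟩
    · rcases le_total (f (t + 1 - s)) 0 with h0 | h0
      · rw [max_eq_right h0, zero_mul]
      · rw [max_eq_left h0]; exact mul_self_nonneg _
    · rw [add_sub_cancel_right, max_eq_left hpos.le]
      exact mul_pos hpos hpos
  · rintro h _ ⟨τ, hτ, u, -, hu, rfl⟩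
    by_cases hint : IntervalIntegrable
        (fun t => exp ((τ - t) • bigA q A) *ᵥ (bigB B *ᵥ u t)) volume 0 τ
    · rw [intervalIntegral_dotProduct η hint, ← neg_nonneg, ← intervalIntegral.integral_neg]
      refine intervalIntegral.integral_nonneg hτ fun t ht => ?_
      rw [integrand_dotProduct, neg_nonneg]
      exact Finset.sum_nonpos fun σ _ =>
        mul_nonpos_of_nonneg_of_nonpos (hu t ht σ) (h σ _ (by linarith [ht.2]))
    -- A non-integrable integrand has integral `0` by convention, and `0` satisfies the inequality.
    · rw [intervalIntegral.integral_undef hint, zero_dotProduct]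

end Polar

/-! ### Generalized eigenspaces -/

section Spectral

variable {n : ℕ}

theorem pow_sub_mulVec (X : Matrix (Fin n) (Fin n) ℂ) (μ : ℂ) (r : ℕ) (v : Fin n → ℂ) :
    ((X.mulVecLin - μ • 1) ^ r) v = (X - μ • 1) ^ r *ᵥ v := by
  induction r generalizing v with
  | zero => simp
  | succ r ih =>
    rw [pow_succ, Module.End.mul_apply, ih, pow_succ, ← Matrix.mulVec_mulVec]
    simp [Matrix.sub_mulVec, Matrix.smul_mulVec]

/-- On its maximal generalized eigenspace `X - μ` is nilpotent, so its characteristic polynomial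
there is a power of the variable. The exponent is the dimension, that is, the algebraic
multiplicity, and Cayley–Hamilton concludes. -/
theorem mem_maxGenEigenspace_iff (X : Matrix (Fin n) (Fin n) ℂ) (μ : ℂ) (v : Fin n → ℂ) :
    v ∈ Module.End.maxGenEigenspace X.mulVecLin μ ↔
      (X - μ • 1) ^ (X.charpoly.rootMultiplicity μ) *ᵥ v = 0 := by
  constructor
  · intro hv
    set f : Module.End ℂ (Fin n → ℂ) := X.mulVecLin with hf
    have hmaps : ∀ x ∈ f.maxGenEigenspace μ, (f - algebraMap ℂ (Module.End ℂ (Fin n → ℂ)) μ) x ∈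
        f.maxGenEigenspace μ := fun x hx => Module.End.mapsTo_maxGenEigenspace_of_comm
      (Algebra.mul_sub_algebraMap_commutes f μ) μ hx
    have hnil := Module.End.isNilpotent_restrict_maxGenEigenspace_sub_algebraMap f μ hmaps
    have hpow := LinearMap.aeval_self_charpoly
      (LinearMap.restrict (f - (algebraMap ℂ (Module.End ℂ (Fin n → ℂ))) μ) hmaps)
    have hch : LinearMap.charpoly f = X.charpoly := Matrix.charpoly_mulVecLin X
    rw [(LinearMap.isNilpotent_iff_charpoly _).mp hnil, map_pow, Polynomial.aeval_X,
      LinearMap.finrank_maxGenEigenspace_eq, hch,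
      Module.End.pow_restrict] at hpow
    have := congrArg Subtype.val (LinearMap.congr_fun hpow ⟨v, hv⟩)
    rw [← pow_sub_mulVec]
    simp only [Module.algebraMap_end_eq_smul_id] at this
    exact this
  · intro hv
    rw [Module.End.mem_maxGenEigenspace]
    exact ⟨_, by rw [pow_sub_mulVec]; exact hv⟩

end Spectral

end

section

/-! ### Modes -/

/-- The columns of `U` form a basis of the generalized eigenspace of `A*` at `μ`, real if `μ` is,
on which `A*` acts by `N*`. -/
structure IsMode {n d : ℕ} (A : Matrix (Fin n) (Fin n) ℝ) (μ : ℂ) (U : Matrix (Fin n) (Fin d) ℂ)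
    (N : Matrix (Fin d) (Fin d) ℂ) : Prop where
  rank : LinearIndependent ℂ U.col
  range : LinearMap.range U.mulVecLin =
    LinearMap.ker ((adj A - μ • (1 : Matrix (Fin n) (Fin n) ℂ)) ^ d).mulVecLin
  mult : d = (adj A).charpoly.rootMultiplicity μ
  comm : adj A * U = U * Nᴴ
  real : μ.im = 0 → ∀ a b, (U a b).im = 0

theorem star_adj_mulVec {n : ℕ} (A : Matrix (Fin n) (Fin n) ℝ) (μ : ℂ) (r : ℕ) (v : Fin n → ℂ) :
    star ((adj A - μ • 1) ^ r *ᵥ v) = (adj A - star μ • 1) ^ r *ᵥ star v := by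
  induction r generalizing v with
  | zero => simp
  | succ r ih =>
    rw [pow_succ, pow_succ, ← Matrix.mulVec_mulVec, ← Matrix.mulVec_mulVec, ih]
    congr 1
    ext a
    rw [Matrix.sub_mulVec, Matrix.sub_mulVec, Matrix.smul_mulVec, Matrix.smul_mulVec,
      Matrix.one_mulVec, Matrix.one_mulVec]
    simp [adj_eq, Matrix.mulVec, dotProduct]

theorem mulVec_ofReal {ι J : Type*} [Fintype J] (M : Matrix ι J ℝ) (x : J → ℝ) :
    M.map Complex.ofReal *ᵥ (Complex.ofReal ∘ x) = Complex.ofReal ∘ (M *ᵥ x) := by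
  ext a
  simp [Matrix.mulVec, dotProduct]

theorem eq_map_ofReal {ι J : Type*} {M : Matrix ι J ℂ} (h : ∀ a b, (M a b).im = 0) :
    M = (M.map Complex.re).map Complex.ofReal := by
  ext a b
  exact Complex.ext rfl (by simp [h])

theorem modalVec_eq {q p d : ℕ} (Λ : Matrix (Fin d) (Fin d) ℂ) (b : Fin q → Fin p → Fin d → ℂ)
    (r : ℕ) (σ : Fin p) : modalVec Λ b r σ = blk q (Λ ^ r) *ᵥ fun a => b a.1 σ a.2 := rfl

theorem modalVec_add {q p d : ℕ} (Λ : Matrix (Fin d) (Fin d) ℂ) (b : Fin q → Fin p → Fin d → ℂ)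
    (s r : ℕ) (σ : Fin p) : modalVec Λ b (s + r) σ = blk q (Λ ^ s) *ᵥ modalVec Λ b r σ := by
  rw [modalVec_eq, modalVec_eq, pow_add, blk_mul, Matrix.mulVec_mulVec]

theorem inc_modalQ_col {q p d : ℕ} (Λ : Matrix (Fin d) (Fin d) ℂ) (b : Fin q → Fin p → Fin d → ℂ)
    (s : Finset (Fin p)) (j : s × Fin d) :
    (inc s (modalQ Λ b)).col j = modalVec Λ b j.2 j.1 := by
  ext a
  rw [modalVec_eq, blk_mulVec_apply]
  rfl

theorem inc_modalQ_re_col {q p d : ℕ} (Λ : Matrix (Fin d) (Fin d) ℂ)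
    (b : Fin q → Fin p → Fin d → ℂ) (s : Finset (Fin p)) (j : s × Fin d) :
    ((inc s (modalQ Λ b)).map Complex.re).col j = fun a => (modalVec Λ b j.2 j.1 a).re := by
  ext a
  rw [← inc_modalQ_col]
  rfl

theorem mem_sdiff_removed {q p d : ℕ} {μ : ℂ} (hμ : μ.im = 0) (Λ : Matrix (Fin d) (Fin d) ℂ)
    (b : Fin q → Fin p → Fin d → ℂ) (s : Finset (Fin p)) (σ : Fin p) :
    σ ∈ s \ removed μ Λ b s ↔
      σ ∈ s ∧ ∀ r < d, (fun a => (modalVec Λ b r σ a).re) ∈ modalSubspace Λ b s := by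
  classical
  rw [removed, if_pos hμ, Finset.mem_sdiff, Finset.mem_filter]
  refine and_congr_right fun hσ => ?_
  rw [not_and]
  constructor
  · intro h r hr
    by_contra hc
    exact h hσ ⟨r, hr, hc⟩
  · rintro h - ⟨r, hr, hc⟩
    exact hc (h r hr)

namespace IsMode

variable {n d : ℕ} {A : Matrix (Fin n) (Fin n) ℝ} {μ : ℂ} {U : Matrix (Fin n) (Fin d) ℂ}
  {N : Matrix (Fin d) (Fin d) ℂ} (h : IsMode A μ U N)

include h

theorem injective : Function.Injective U.mulVec := Matrix.mulVec_injective_iff.mpr h.rank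

theorem mul_left_cancel {s : ℕ} {M M' : Matrix (Fin d) (Fin s) ℂ} (e : U * M = U * M') :
    M = M' := by
  refine Matrix.ext_of_mulVec_single fun i => h.injective ?_
  rw [Matrix.mulVec_mulVec, Matrix.mulVec_mulVec, e]

theorem exists_mulVec_iff (v : Fin n → ℂ) :
    (∃ c, U *ᵥ c = v) ↔ v ∈ Module.End.maxGenEigenspace (adj A).mulVecLin μ := by
  rw [mem_maxGenEigenspace_iff, ← h.mult]
  have := congrArg (v ∈ ·) h.range
  simpa [LinearMap.mem_range, LinearMap.mem_ker] using this

theorem pow_mul (r : ℕ) : (adj A - μ • 1) ^ r * U = U * (Nᴴ - μ • 1) ^ r := by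
  induction r with
  | zero => simp
  | succ r ih =>
    have e : (adj A - μ • 1) * U = U * (Nᴴ - μ • 1) := by
      rw [Matrix.sub_mul, Matrix.mul_sub, h.comm]
      simp
    rw [pow_succ', Matrix.mul_assoc, ih, ← Matrix.mul_assoc, e, pow_succ', Matrix.mul_assoc]

theorem pow_mul_eq_zero : (adj A - μ • 1) ^ d * U = 0 := by
  refine Matrix.ext_of_mulVec_single fun i => ?_
  rw [← Matrix.mulVec_mulVec, Matrix.zero_mulVec]
  have : U *ᵥ Pi.single i 1 ∈ LinearMap.range U.mulVecLin := ⟨_, rfl⟩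
  rw [h.range] at this
  simpa using this

omit h in
theorem nilPart_conjTranspose : (nilPart μ N)ᴴ = Nᴴ - μ • 1 := by
  rw [nilPart, Matrix.conjTranspose_conjTranspose]

theorem nilPart_pow_eq_zero : nilPart μ N ^ d = 0 := by
  have : (Nᴴ - μ • 1) ^ d = 0 :=
    h.mul_left_cancel (by rw [← h.pow_mul, h.pow_mul_eq_zero, Matrix.mul_zero])
  rw [← Matrix.conjTranspose_eq_zero, Matrix.conjTranspose_pow, nilPart_conjTranspose, this]

/-- Conjugating `U M = (A* - μ) U` with `U`, `A*` and `μ` real gives `U conj(M) = U M`, and `U` is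
injective. -/
theorem nilPart_real (hμ : μ.im = 0) (a b : Fin d) : (nilPart μ N a b).im = 0 := by
  set M := Nᴴ - μ • (1 : Matrix (Fin d) (Fin d) ℂ) with hM
  have hUM : U * M = (adj A - μ • 1) * U := by
    have := h.pow_mul 1
    rw [pow_one, pow_one] at this
    exact this.symm
  have hU : U.map star = U := by
    ext a b
    exact Complex.conj_eq_iff_im.mpr (h.real hμ a b)
  have hX : (adj A - μ • (1 : Matrix (Fin n) (Fin n) ℂ)).map star = adj A - μ • 1 := by
    ext a b
    by_cases hab : a = b <;> simp [adj_eq, hab, Complex.conj_eq_iff_im.mpr hμ]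
  have hmap : ∀ {a b c : ℕ} (P : Matrix (Fin a) (Fin b) ℂ) (Q : Matrix (Fin b) (Fin c) ℂ),
      (P * Q).map star = P.map star * Q.map star := by
    intro a b c P Q
    ext i j
    simp [Matrix.mul_apply]
  have hMM : M.map star = M := by
    apply h.mul_left_cancel
    conv_lhs => rw [← hU]
    rw [← hmap, hUM, hmap, hU, hX]
  have e : nilPart μ N a b = star (M b a) := by
    rw [nilPart, Matrix.conjTranspose_apply]
  have e2 : star (M b a) = M b a := congrFun (congrFun hMM b) a
  rw [e, e2]
  exact Complex.conj_eq_iff_im.mp e2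

variable {q p : ℕ} (B : Fin q → Fin p → Fin n → ℝ)

/-- The relation `(A* - μ)^r U = U (N* - μ)^r` carries the powers of `Λ` from the modal input over
to the generalized eigenvector. This identifies the coefficients of the response. -/
theorem modalVec_dotProduct (r : ℕ) (σ : Fin p) (c : Fin q × Fin d → ℂ) :
    star (modalVec (nilPart μ N) (modalB U B) r σ) ⬝ᵥ c =
      (Complex.ofReal ∘ inputVec B σ) ⬝ᵥ
        ((blk q (adj A) - μ • 1) ^ r *ᵥ (blk q U *ᵥ c)) := by
  have e1 : (fun a : Fin q × Fin d => modalB U B a.1 σ a.2) =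
      blk q Uᴴ *ᵥ (Complex.ofReal ∘ inputVec B σ) := by
    ext a
    rw [blk_mulVec_apply]
    rfl
  have e2 : (blk q (adj A) - μ • 1) ^ r * blk q U = blk q (U * (Nᴴ - μ • 1) ^ r) := by
    rw [← h.pow_mul, blk_mul, blk_pow, blk_sub, blk_smul, blk_one]
  rw [modalVec_eq, e1, Matrix.mulVec_mulVec, ← blk_mul, Matrix.mulVec_mulVec, e2,
    Matrix.star_mulVec, ← Matrix.dotProduct_mulVec, blk_conjTranspose, Matrix.conjTranspose_mul,
    Matrix.conjTranspose_conjTranspose, Matrix.conjTranspose_pow, nilPart_conjTranspose]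
  congr 1
  ext a
  simp

/-- The response of a mode. -/
theorem resp_mode (σ : Fin p) (c : Fin q × Fin d → ℂ) (t : ℝ) :
    resp A B σ (blk q U *ᵥ c) t = Complex.exp (μ * t) *
      (expPoly d fun r => star (modalVec (nilPart μ N) (modalB U B) r σ) ⬝ᵥ c).eval (t : ℂ) := by
  have hv : (blk q (adj A) - μ • 1) ^ d *ᵥ (blk q U *ᵥ c) = 0 := by
    rw [Matrix.mulVec_mulVec, ← blk_one, ← blk_smul, ← blk_sub, ← blk_pow, ← blk_mul,
      h.pow_mul_eq_zero, blk_zero, Matrix.zero_mulVec]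
  rw [resp, exp_smul_mulVec_of_pow_eq_zero _ μ hv, dotProduct_smul, dotProduct_sum, smul_eq_mul,
    expPoly_eval]
  congr 1
  refine Finset.sum_congr rfl fun r _ => ?_
  rw [dotProduct_smul, smul_eq_mul, h.modalVec_dotProduct]

theorem modalB_real (hμ : μ.im = 0) (i : Fin q) (σ : Fin p) (a : Fin d) :
    (modalB U B i σ a).im = 0 := by
  simp [modalB, Matrix.mulVec, dotProduct, h.real hμ]

theorem modalVec_real (hμ : μ.im = 0) (r : ℕ) (σ : Fin p) :
    modalVec (nilPart μ N) (modalB U B) r σ =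
      Complex.ofReal ∘ fun a => (modalVec (nilPart μ N) (modalB U B) r σ a).re := by
  induction r with
  | zero =>
    ext a
    refine Complex.ext rfl ?_
    rw [modalVec_eq, pow_zero, blk_one, Matrix.one_mulVec]
    simpa using h.modalB_real B hμ _ _ _
  | succ r ih =>
    have hΛ := eq_map_ofReal (h.nilPart_real hμ)
    rw [add_comm, modalVec_add, pow_one, ih, hΛ, ← blk_map_ofReal, mulVec_ofReal]
    ext a; simp

theorem modalVec_eq_zero {r : ℕ} (hr : d ≤ r) (σ : Fin p) :
    modalVec (nilPart μ N) (modalB U B) r σ = 0 := by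
  rw [modalVec_eq, pow_eq_zero_of_le hr h.nilPart_pow_eq_zero, blk_zero, Matrix.zero_mulVec]

theorem realVec_add (hμ : μ.im = 0) (s r : ℕ) (σ : Fin p) :
    (fun a => (modalVec (nilPart μ N) (modalB U B) (s + r) σ a).re) =
      blk q ((nilPart μ N).map Complex.re ^ s) *ᵥ
        fun a => (modalVec (nilPart μ N) (modalB U B) r σ a).re := by
  have hΛ := eq_map_ofReal (h.nilPart_real hμ)
  have hpow : nilPart μ N ^ s = ((nilPart μ N).map Complex.re ^ s).map Complex.ofReal := by
    conv_lhs => rw [hΛ]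
    exact (map_pow (Complex.ofRealHom.mapMatrix) _ _).symm
  have e := modalVec_add (nilPart μ N) (modalB U B) s r σ
  rw [h.modalVec_real B hμ r, hpow, ← blk_map_ofReal, mulVec_ofReal] at e
  rw [e]
  ext a; simp

theorem re_nilPart_pow_eq_zero (hμ : μ.im = 0) : (nilPart μ N).map Complex.re ^ d = 0 := by
  have hΛ := eq_map_ofReal (h.nilPart_real hμ)
  have e := h.nilPart_pow_eq_zero
  rw [hΛ] at e
  have e2 : ((nilPart μ N).map Complex.re ^ d).map Complex.ofReal = 0 := by
    rw [← e]
    exact map_pow (Complex.ofRealHom.mapMatrix) _ _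
  ext a b
  have := congrFun (congrFun e2 a) b
  simpa using this

theorem dotProduct_real (hμ : μ.im = 0) (r : ℕ) (σ : Fin p) (c : Fin q × Fin d → ℝ) :
    star (modalVec (nilPart μ N) (modalB U B) r σ) ⬝ᵥ (Complex.ofReal ∘ c) =
      (((fun a => (modalVec (nilPart μ N) (modalB U B) r σ a).re) ⬝ᵥ c : ℝ) : ℂ) := by
  rw [h.modalVec_real B hμ]
  simp [dotProduct]

/-- Translation in time along a real mode. -/
theorem exists_shift (hμ : μ.im = 0) (t : ℝ) (c : Fin q × Fin d → ℝ) :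
    ∃ c' : Fin q × Fin d → ℝ,
      (∀ r σ, (fun a => (modalVec (nilPart μ N) (modalB U B) r σ a).re) ⬝ᵥ c' =
        (expPoly d fun s =>
          (fun a => (modalVec (nilPart μ N) (modalB U B) (s + r) σ a).re) ⬝ᵥ c).eval t) ∧
      ∀ k l, (∀ j, c' (k, j) = c' (l, j)) → ∀ j, c (k, j) = c (l, j) := by
  set L := (nilPart μ N).map Complex.re with hL
  set T := t • Lᵀ with hT
  have hTd : T ^ d = 0 := by
    rw [hT, smul_pow, ← Matrix.transpose_pow, h.re_nilPart_pow_eq_zero hμ]; simp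
  have hnil : IsNilpotent T := ⟨d, hTd⟩
  -- The translate is `exp(tΛᵀ) c` in each block. Expanding the finite exponential gives the shifted
  -- polynomials; the same invertible matrix acts on every block, so equality of two blocks can be
  -- pulled back.
  refine ⟨blk q (IsNilpotent.exp T) *ᵥ c, fun r σ => ?_, fun k l hkl j => ?_⟩
  · rw [IsNilpotent.exp_eq_sum hTd, blk_sum, Matrix.sum_mulVec, dotProduct_sum, expPoly_eval]
    refine Finset.sum_congr rfl fun s _ => ?_
    have e : ((s.factorial : ℚ)⁻¹ • T ^ s) = (t ^ s / s.factorial) • (L ^ s)ᵀ := by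
      rw [hT, smul_pow, ← Matrix.transpose_pow]
      ext a b
      simp [Rat.smul_def]
      ring
    rw [e, blk_smul, Matrix.smul_mulVec, dotProduct_smul, smul_eq_mul, h.realVec_add B hμ s r σ,
      ← blk_transpose, Matrix.mulVec_transpose, dotProduct_comm, ← Matrix.dotProduct_mulVec,
      dotProduct_comm]
  · have hinv := IsNilpotent.exp_neg_mul_exp_self hnil
    have hc : ∀ i, (fun j => c (i, j)) = IsNilpotent.exp (-T) *ᵥ
        fun j => (blk q (IsNilpotent.exp T) *ᵥ c) (i, j) := by
      intro i
      have : (fun j => (blk q (IsNilpotent.exp T) *ᵥ c) (i, j)) =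
          IsNilpotent.exp T *ᵥ fun j => c (i, j) := by
        ext j; rw [blk_mulVec_apply]
      rw [this, Matrix.mulVec_mulVec, hinv, Matrix.one_mulVec]
    have : (fun j => c (k, j)) = fun j => c (l, j) := by
      rw [hc k, hc l]
      congr 1
      ext j
      exact hkl j
    exact congrFun this j

/-- The real response of a real mode. -/
theorem realResp_mode (hμ : μ.im = 0) (σ : Fin p) (c : Fin q × Fin d → ℝ) (t : ℝ) :
    realResp A B σ (blk q (U.map Complex.re) *ᵥ c) t = Real.exp (μ.re * t) *
      (expPoly d fun r =>
        (fun a => (modalVec (nilPart μ N) (modalB U B) r σ a).re) ⬝ᵥ c).eval t := by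
  have e := h.resp_mode B σ (Complex.ofReal ∘ c) t
  have hU := eq_map_ofReal (h.real hμ)
  rw [expPoly_eval] at e ⊢
  simp only [h.dotProduct_real B hμ] at e
  have hv : blk q U *ᵥ (Complex.ofReal ∘ c) =
      Complex.ofReal ∘ (blk q (U.map Complex.re) *ᵥ c) := by
    conv_lhs => rw [hU]
    rw [← blk_map_ofReal, mulVec_ofReal]
  rw [hv, resp_ofReal] at e
  apply Complex.ofReal_injective
  have hexp : Complex.exp (μ * t) = (Real.exp (μ.re * t) : ℂ) := by
    have hμ' : μ = (μ.re : ℂ) := Complex.ext rfl (by simpa using hμ)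
    conv_lhs => rw [hμ']
    push_cast
    rfl
  rw [e, hexp]
  push_cast
  rfl

theorem blk_injective {q : ℕ} {c : Fin q × Fin d → ℂ} {k l : Fin q}
    (e : ∀ j, (blk q U *ᵥ c) (k, j) = (blk q U *ᵥ c) (l, j)) (j : Fin d) : c (k, j) = c (l, j) := by
  have : (fun j => c (k, j)) = fun j => c (l, j) := by
    apply h.injective
    ext j
    have := e j
    rwa [blk_mulVec_apply, blk_mulVec_apply] at this
  exact congrFun this j

end IsMode

/-! ### Modal decomposition -/

section Decomposition

variable {n q m : ℕ} {A : Matrix (Fin n) (Fin n) ℝ} {μ : Fin m → ℂ} {d : Fin m → ℕ}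
  {U : ∀ κ, Matrix (Fin n) (Fin (d κ)) ℂ} {N : ∀ κ, Matrix (Fin (d κ)) (Fin (d κ)) ℂ}

theorem exists_modal_sum (hμ_range : spectrum ℂ (adj A) ⊆ Set.range μ)
    (hmode : ∀ κ, IsMode A (μ κ) (U κ) (N κ)) (v : Fin n → ℂ) :
    ∃ c : ∀ κ, Fin (d κ) → ℂ, v = ∑ κ, U κ *ᵥ c κ := by
  have htop := Module.End.iSup_maxGenEigenspace_eq_top (adj A).mulVecLin
  have hle : (⨆ z : ℂ, Module.End.maxGenEigenspace (adj A).mulVecLin z) ≤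
      ⨆ κ, LinearMap.range (U κ).mulVecLin := by
    refine iSup_le fun z => ?_
    by_cases hz : z ∈ spectrum ℂ (adj A)
    · obtain ⟨κ, rfl⟩ := hμ_range hz
      refine le_trans (fun x hx => ?_) (le_iSup _ κ)
      exact ((hmode κ).exists_mulVec_iff x).mpr hx
    · have : Module.End.maxGenEigenspace (adj A).mulVecLin z = ⊥ := by
        rw [eq_bot_iff]
        intro x hx
        rw [mem_maxGenEigenspace_iff, Polynomial.rootMultiplicity_eq_zero] at hx
        · simpa using hx
        · rwa [← Matrix.mem_spectrum_iff_isRoot_charpoly]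
      rw [this]
      exact bot_le
  rw [htop, top_le_iff] at hle
  have hv : v ∈ ⨆ κ, LinearMap.range (U κ).mulVecLin := hle ▸ Submodule.mem_top
  obtain ⟨w, hw, hsum⟩ := (Submodule.mem_iSup_iff_exists_finsupp _ _).mp hv
  choose c hc using hw
  refine ⟨c, ?_⟩
  rw [← hsum, Finsupp.sum_fintype _ _ (by simp)]
  exact Finset.sum_congr rfl fun κ _ => (hc κ).symm

theorem exists_blk_modal_sum (hμ_range : spectrum ℂ (adj A) ⊆ Set.range μ)
    (hmode : ∀ κ, IsMode A (μ κ) (U κ) (N κ)) (v : Fin q × Fin n → ℂ) :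
    ∃ c : ∀ κ, Fin q × Fin (d κ) → ℂ, v = ∑ κ, blk q (U κ) *ᵥ c κ := by
  choose c hc using fun i : Fin q => exists_modal_sum hμ_range hmode fun j => v (i, j)
  refine ⟨fun κ a => c a.1 κ a.2, ?_⟩
  ext ⟨i, j⟩
  have := congrFun (hc i) j
  rw [this]
  simp [Finset.sum_apply, blk_mulVec_apply]

/-- Since `A*` is real, conjugation sends the generalized eigenspace at `μ κ` to that at its
conjugate, and fixes the one at a real `μ ν`. By independence of these spaces the component at `μ ν`
of a real vector is real, and so are its coordinates, as `U ν` is real and injective. -/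
theorem modal_sum_real (hμ_inj : Function.Injective μ)
    (hmode : ∀ κ, IsMode A (μ κ) (U κ) (N κ)) {c : ∀ κ, Fin (d κ) → ℂ}
    (hreal : star (∑ κ, U κ *ᵥ c κ) = ∑ κ, U κ *ᵥ c κ) {ν : Fin m} (hν : (μ ν).im = 0) :
    star (c ν) = c ν := by
  classical
  set G := Module.End.maxGenEigenspace (adj A).mulVecLin with hG
  have hmem : ∀ κ, U κ *ᵥ c κ ∈ G (μ κ) := fun κ => ((hmode κ).exists_mulVec_iff _).mp ⟨_, rfl⟩
  have hstar : ∀ κ, star (U κ *ᵥ c κ) ∈ G (star (μ κ)) := by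
    intro κ
    obtain ⟨r, hr⟩ := (Module.End.mem_maxGenEigenspace _ _ _).mp (hmem κ)
    refine (Module.End.mem_maxGenEigenspace _ _ _).mpr ⟨r, ?_⟩
    rw [pow_sub_mulVec] at hr ⊢
    rw [← star_adj_mulVec, hr, star_zero]
  have hμν : star (μ ν) = μ ν := Complex.conj_eq_iff_im.mpr hν
  have hind := Module.End.independent_maxGenEigenspace (adj A).mulVecLin
  have hdisj := hind (μ ν)
  have hother : ∀ z, z ≠ μ ν → G z ≤ ⨆ j, ⨆ (_ : j ≠ μ ν), G j := fun z hz =>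
    le_iSup₂_of_le z hz le_rfl
  have e : star (U ν *ᵥ c ν) - U ν *ᵥ c ν =
      ∑ κ ∈ Finset.univ.erase ν, (U κ *ᵥ c κ - star (U κ *ᵥ c κ)) := by
    rw [star_sum, ← Finset.add_sum_erase _ _ (Finset.mem_univ ν),
      ← Finset.add_sum_erase _ _ (Finset.mem_univ ν)] at hreal
    rw [Finset.sum_sub_distrib, sub_eq_sub_iff_add_eq_add, add_comm _ (U ν *ᵥ c ν), ← hreal]
  have h0 : star (U ν *ᵥ c ν) - U ν *ᵥ c ν = 0 := by
    refine Submodule.disjoint_def.mp hdisj _ (Submodule.sub_mem _ ?_ (hmem ν)) ?_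
    · have := hstar ν
      rwa [hμν] at this
    · rw [e]
      refine Submodule.sum_mem _ fun κ hκ => ?_
      have hne : μ κ ≠ μ ν := fun h => (Finset.mem_erase.mp hκ).1 (hμ_inj h)
      refine Submodule.sub_mem _ (hother _ hne (hmem κ)) (hother _ ?_ (hstar κ))
      intro h
      exact hne (star_injective (h.trans hμν.symm))
  apply (hmode ν).injective
  rw [← sub_eq_zero.mp h0]
  ext a
  simp only [Matrix.mulVec, dotProduct, Pi.star_apply, star_sum, star_mul']
  refine Finset.sum_congr rfl fun b _ => ?_
  rw [show star (U ν a b) = U ν a b from Complex.conj_eq_iff_im.mpr ((hmode ν).real hν a b)]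

theorem blk_modal_sum_real (hμ_inj : Function.Injective μ)
    (hmode : ∀ κ, IsMode A (μ κ) (U κ) (N κ)) {c : ∀ κ, Fin q × Fin (d κ) → ℂ}
    {η : Fin q × Fin n → ℝ} (hη : Complex.ofReal ∘ η = ∑ κ, blk q (U κ) *ᵥ c κ) {ν : Fin m}
    (hν : (μ ν).im = 0) : c ν = Complex.ofReal ∘ fun a => (c ν a).re := by
  ext ⟨i, j⟩
  have e : (fun j => (η (i, j) : ℂ)) = ∑ κ, U κ *ᵥ fun j => c κ (i, j) := by
    ext j
    have := congrFun hη (i, j)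
    simp only [Function.comp_apply] at this
    rw [this]
    simp [Finset.sum_apply, blk_mulVec_apply]
  have := modal_sum_real hμ_inj hmode (c := fun κ j => c κ (i, j)) (by
    rw [← e]; ext j; simp) hν
  have := congrFun this j
  exact (Complex.conj_eq_iff_re.mp this).symm

end Decomposition

end

section

open Filter Topology

/-! ### Growth of exponential polynomials -/

/-- A single term of the exponential series gives `(δ‖x‖)^r / r! ≤ e^{δ‖x‖}`. Polynomial factors
thus cost an arbitrarily small increase of the exponential rate. -/
theorem exists_norm_expPoly_le {𝕜 : Type*} [RCLike 𝕜] (d : ℕ) (g : ℕ → 𝕜) {δ : ℝ} (hδ : 0 < δ) :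
    ∃ C : ℝ, ∀ x : 𝕜, ‖(expPoly d g).eval x‖ ≤ C * Real.exp (δ * ‖x‖) := by
  refine ⟨∑ r ∈ Finset.range d, (δ ^ r)⁻¹ * ‖g r‖, fun x => ?_⟩
  rw [expPoly_eval, Finset.sum_mul]
  refine (norm_sum_le _ _).trans (Finset.sum_le_sum fun r _ => ?_)
  have h := Real.pow_div_factorial_le_exp (δ * ‖x‖) (by positivity) r
  rw [norm_mul, norm_div, norm_pow, RCLike.norm_natCast, mul_right_comm]
  refine mul_le_mul_of_nonneg_right ?_ (norm_nonneg _)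
  rw [← div_eq_inv_mul, le_div_iff₀ (by positivity)]
  calc ‖x‖ ^ r / r.factorial * δ ^ r = (δ * ‖x‖) ^ r / r.factorial := by rw [mul_pow]; ring
    _ ≤ _ := h

namespace IsMode

variable {n d q p : ℕ} {A : Matrix (Fin n) (Fin n) ℝ} {μ : ℂ} {U : Matrix (Fin n) (Fin d) ℂ}
  {N : Matrix (Fin d) (Fin d) ℂ} (h : IsMode A μ U N) (B : Fin q → Fin p → Fin n → ℝ)

include h

theorem exists_norm_resp_le {ρ : ℝ} (hρ : μ.re < ρ) (σ : Fin p) (c : Fin q × Fin d → ℂ) :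
    ∃ C : ℝ, ∀ t : ℝ, 0 ≤ t → ‖resp A B σ (blk q U *ᵥ c) t‖ ≤ C * Real.exp (ρ * t) := by
  obtain ⟨C, hC⟩ := exists_norm_expPoly_le d
    (fun r => star (modalVec (nilPart μ N) (modalB U B) r σ) ⬝ᵥ c) (sub_pos.mpr hρ)
  refine ⟨C, fun t ht => ?_⟩
  have := hC (t : ℂ)
  rw [Complex.norm_real, Real.norm_of_nonneg ht] at this
  rw [h.resp_mode, norm_mul, Complex.norm_exp]
  have e : (μ * t).re = μ.re * t := by simp
  rw [e]
  calc _ ≤ Real.exp (μ.re * t) * (C * Real.exp ((ρ - μ.re) * t)) := by gcongr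
    _ = C * Real.exp (ρ * t) := by
      rw [mul_left_comm, ← Real.exp_add]; congr 2; ring

/-- With `Λ = 0` the columns of `U` are true eigenvectors and no polynomial factor arises. The exact
rate matters when a nonreal eigenvalue shares its real part with a real one. -/
theorem exists_norm_resp_le_of_nilPart_eq_zero (hΛ : nilPart μ N = 0) (σ : Fin p)
    (c : Fin q × Fin d → ℂ) :
    ∃ C : ℝ, ∀ t : ℝ, 0 ≤ t → ‖resp A B σ (blk q U *ᵥ c) t‖ ≤ C * Real.exp (μ.re * t) := by
  refine ⟨‖(Complex.ofReal ∘ inputVec B σ) ⬝ᵥ (blk q U *ᵥ c)‖, fun t _ => ?_⟩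
  have hU : adj A * U = μ • U := by
    have h1 : Nᴴ - μ • 1 = 0 := by rw [← nilPart_conjTranspose, hΛ, Matrix.conjTranspose_zero]
    rw [h.comm, sub_eq_zero.mp h1]
    simp
  have h1 : (blk q (adj A) - μ • 1) ^ 1 *ᵥ (blk q U *ᵥ c) = 0 := by
    rw [pow_one, Matrix.sub_mulVec, Matrix.mulVec_mulVec, ← blk_mul, hU, blk_smul,
      Matrix.smul_mulVec, Matrix.smul_mulVec, Matrix.one_mulVec, sub_self]
  rw [resp, exp_smul_mulVec_of_pow_eq_zero _ μ h1, dotProduct_smul, norm_smul, Complex.norm_exp,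
    mul_comm]
  simp

theorem blk_ofReal (hμ : μ.im = 0) (c : Fin q × Fin d → ℝ) :
    blk q U *ᵥ (Complex.ofReal ∘ c) = Complex.ofReal ∘ (blk q (U.map Complex.re) *ᵥ c) := by
  have hU := eq_map_ofReal (h.real hμ)
  conv_lhs => rw [hU]
  rw [← blk_map_ofReal, mulVec_ofReal]

theorem exists_abs_realResp_le (hμ : μ.im = 0) {ρ : ℝ} (hρ : μ.re < ρ) (σ : Fin p)
    (c : Fin q × Fin d → ℝ) :
    ∃ C : ℝ, ∀ t : ℝ, 0 ≤ t →
      |realResp A B σ (blk q (U.map Complex.re) *ᵥ c) t| ≤ C * Real.exp (ρ * t) := by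
  obtain ⟨C, hC⟩ := h.exists_norm_resp_le B hρ σ (Complex.ofReal ∘ c)
  refine ⟨C, fun t ht => ?_⟩
  have := hC t ht
  rwa [h.blk_ofReal hμ, resp_ofReal, Complex.norm_real, Real.norm_eq_abs] at this

theorem realResp_nonpos (hμ : μ.im = 0) {σ : Fin p} {c : Fin q × Fin d → ℝ}
    (hc : ∀ r < d, (fun a => (modalVec (nilPart μ N) (modalB U B) r σ a).re) ⬝ᵥ c ≤ 0)
    {t : ℝ} (ht : 0 ≤ t) : realResp A B σ (blk q (U.map Complex.re) *ᵥ c) t ≤ 0 := by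
  rw [h.realResp_mode B hμ, expPoly_eval]
  refine mul_nonpos_of_nonneg_of_nonpos (Real.exp_pos _).le
    (Finset.sum_nonpos fun r hr => mul_nonpos_of_nonneg_of_nonpos (by positivity)
      (hc r (Finset.mem_range.mp hr)))

/-- A combination of real generalized eigenvectors whose response vanishes for the inputs kept at
a real eigenvalue and is uniformly negative for the inputs removed. -/
theorem exists_removing_vector (hμ : μ.im = 0) (s : Finset (Fin p)) :
    ∃ w : Fin q × Fin n → ℝ,
      (∀ σ ∈ s \ removed μ (nilPart μ N) (modalB U B) s, ∀ t, realResp A B σ w t = 0) ∧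
      (∀ σ ∈ s, σ ∉ s \ removed μ (nilPart μ N) (modalB U B) s →
        ∃ ε > 0, ∀ t, 0 ≤ t → realResp A B σ w t ≤ -ε * Real.exp (μ.re * t)) ∧
      ∀ ρ, μ.re < ρ → ∀ σ, ∃ C : ℝ, ∀ t, 0 ≤ t → |realResp A B σ w t| ≤ C * Real.exp (ρ * t) := by
  obtain ⟨c, hc, hcneg⟩ := exists_polar_neg
    ((inc s (modalQ (nilPart μ N) (modalB U B))).map Complex.re)
  -- For a removed input `c` may be strictly negative only on some `Λ^r b`. Translating by time `1`
  -- adds a positive multiple of each such pairing to the one with `b`, making the constant term of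
  -- the response polynomial negative.
  obtain ⟨c', hc', -⟩ := h.exists_shift B hμ 1 c
  set v : ℕ → Fin p → Fin q × Fin d → ℝ :=
    fun r σ a => (modalVec (nilPart μ N) (modalB U B) r σ a).re with hv
  have hv0 : ∀ r σ, d ≤ r → v r σ = 0 := by
    intro r σ hr
    ext a
    simp [hv, h.modalVec_eq_zero B hr]
  have hle : ∀ σ ∈ s, ∀ r, v r σ ⬝ᵥ c ≤ 0 := by
    intro σ hσ r
    by_cases hr : r < d
    · have := hc (⟨σ, hσ⟩, ⟨r, hr⟩)
      rwa [inc_modalQ_re_col] at this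
    · rw [hv0 r σ (not_lt.mp hr), zero_dotProduct]
  have hshift : ∀ r σ, v r σ ⬝ᵥ c' =
      ∑ i ∈ Finset.range d, (1 : ℝ) ^ i / i.factorial * (v (i + r) σ ⬝ᵥ c) := fun r σ => by
    rw [← expPoly_eval]; exact hc' r σ
  have hle' : ∀ σ ∈ s, ∀ r, v r σ ⬝ᵥ c' ≤ 0 := by
    intro σ hσ r
    rw [hshift]
    exact Finset.sum_nonpos fun i _ =>
      mul_nonpos_of_nonneg_of_nonpos (by positivity) (hle σ hσ _)
  refine ⟨blk q (U.map Complex.re) *ᵥ c', fun σ hσ t => ?_, fun σ hσ hσr => ?_,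
    fun ρ hρ σ => h.exists_abs_realResp_le B hμ hρ σ c'⟩
  · obtain ⟨hσs, hσl⟩ := (mem_sdiff_removed hμ _ _ _ _).mp hσ
    have hz : ∀ r, v r σ ⬝ᵥ c = 0 := by
      intro r
      by_cases hr : r < d
      · exact dotProduct_eq_zero_of_mem_lineal hc (hσl r hr)
      · rw [hv0 r σ (not_lt.mp hr), zero_dotProduct]
    rw [h.realResp_mode B hμ, expPoly_eval, Finset.sum_eq_zero, mul_zero]
    intro r _
    change _ * (v r σ ⬝ᵥ c') = 0
    rw [hshift, Finset.sum_eq_zero, mul_zero]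
    intro i _
    rw [hz, mul_zero]
  · rw [mem_sdiff_removed hμ, not_and] at hσr
    have := hσr hσ
    push Not at this
    obtain ⟨r, hr, hrl⟩ := this
    have hneg : v r σ ⬝ᵥ c < 0 := by
      have := hcneg (⟨σ, hσ⟩, ⟨r, hr⟩)
      rw [inc_modalQ_re_col] at this
      exact this hrl
    have hd : 0 < d := by omega
    have hneg' : v 0 σ ⬝ᵥ c' < 0 := by
      rw [hshift]
      refine Finset.sum_neg' (fun i _ =>
        mul_nonpos_of_nonneg_of_nonpos (by positivity) (hle σ hσ _))
        ⟨r, Finset.mem_range.mpr hr, ?_⟩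
      rw [add_zero]
      exact mul_neg_of_pos_of_neg (by positivity) hneg
    refine ⟨-(v 0 σ ⬝ᵥ c'), by linarith, fun t ht => ?_⟩
    rw [h.realResp_mode B hμ, expPoly_eval, neg_neg, mul_comm]
    refine mul_le_mul_of_nonneg_right ?_ (Real.exp_pos _).le
    obtain ⟨d', rfl⟩ : ∃ d', d = d' + 1 := ⟨d - 1, by omega⟩
    rw [Finset.sum_range_succ']
    have : ∑ i ∈ Finset.range d', t ^ (i + 1) / (i + 1).factorial * (v (i + 1) σ ⬝ᵥ c') ≤ 0 :=
      Finset.sum_nonpos fun i _ =>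
        mul_nonpos_of_nonneg_of_nonpos (by positivity) (hle' σ hσ _)
    simp only [pow_zero, Nat.factorial_zero, Nat.cast_one, div_one, one_mul]
    exact add_le_of_nonpos_left this

end IsMode

/-! ### Index sets -/

section IndexSet

variable {q p m : ℕ} {d : Fin m → ℕ} (μ : Fin m → ℂ)
  (Λ : ∀ κ, Matrix (Fin (d κ)) (Fin (d κ)) ℂ) (b : ∀ κ, Fin q → Fin p → Fin (d κ) → ℂ)

theorem indexSet_succ (κ : Fin m) : indexSet μ Λ b (κ + 1) =
    indexSet μ Λ b κ \ removed (μ κ) (Λ κ) (b κ) (indexSet μ Λ b κ) := by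
  rw [indexSet, dif_pos κ.2]

theorem indexSet_succ_of_le {j : ℕ} (hj : m ≤ j) :
    indexSet μ Λ b (j + 1) = indexSet μ Λ b j := by
  rw [indexSet, dif_neg (not_lt.mpr hj)]

theorem indexSet_succ_of_nonreal {κ : Fin m} (hκ : (μ κ).im ≠ 0) :
    indexSet μ Λ b (κ + 1) = indexSet μ Λ b κ := by
  rw [indexSet_succ, removed, if_neg hκ, Finset.sdiff_empty]

theorem indexSet_antitone : Antitone (indexSet μ Λ b) := by
  refine antitone_nat_of_succ_le fun j => ?_
  by_cases hj : j < m
  · exact (indexSet_succ μ Λ b ⟨j, hj⟩).trans_le Finset.sdiff_subset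
  · exact (indexSet_succ_of_le μ Λ b (not_lt.mp hj)).le

end IndexSet

/-! ### Dual forms of connectivity for the mode matrices. -/

section Connectivity

variable {n q p m : ℕ} {A : Matrix (Fin n) (Fin n) ℝ} (B : Fin q → Fin p → Fin n → ℝ)
  {μ : Fin m → ℂ} {d : Fin m → ℕ} {U : ∀ κ, Matrix (Fin n) (Fin (d κ)) ℂ}
  {N : ∀ κ, Matrix (Fin (d κ)) (Fin (d κ)) ℂ} (k l : Fin q)

theorem isConn_modeMatrix_iff (κ : Fin m) :
    IsConn k l (modeMatrix B μ U N κ) ↔ ∀ c : Fin q × Fin (d κ) → ℂ,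
      (∀ σ ∈ indexSet μ (fun κ => nilPart (μ κ) (N κ)) (fun κ => modalB (U κ) B) κ, ∀ r < d κ,
        star (modalVec (nilPart (μ κ) (N κ)) (modalB (U κ) B) r σ) ⬝ᵥ c = 0) →
      ∀ j, c (k, j) = c (l, j) := by
  rw [isConn_iff]
  refine forall_congr' fun c => imp_congr_left ?_
  simp only [modeMatrix, inc_modalQ_col]
  exact ⟨fun h σ hσ r hr => h (⟨σ, hσ⟩, ⟨r, hr⟩), fun h j => h _ j.1.2 _ j.2.2⟩

theorem isStronglyConn_modeMatrix_iff {κ : Fin m} (h : IsMode A (μ κ) (U κ) (N κ))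
    (hκ : (μ κ).im = 0) :
    IsStronglyConn k l (modeMatrix B μ U N κ) ↔ ∀ c : Fin q × Fin (d κ) → ℝ,
      (∀ σ ∈ indexSet μ (fun κ => nilPart (μ κ) (N κ)) (fun κ => modalB (U κ) B) κ, ∀ r < d κ,
        (fun a => (modalVec (nilPart (μ κ) (N κ)) (modalB (U κ) B) r σ a).re) ⬝ᵥ c ≤ 0) →
      ∀ j, c (k, j) = c (l, j) := by
  rw [isStronglyConn_iff, and_iff_right]
  · refine forall_congr' fun c => imp_congr_left ?_
    simp only [modeMatrix, inc_modalQ_re_col]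
    exact ⟨fun h σ hσ r hr => h (⟨σ, hσ⟩, ⟨r, hr⟩), fun h j => h _ j.1.2 _ j.2.2⟩
  · intro a j
    have e := congrFun (inc_modalQ_col (nilPart (μ κ) (N κ)) (modalB (U κ) B)
      (indexSet μ (fun κ => nilPart (μ κ) (N κ)) (fun κ => modalB (U κ) B) κ) j) a
    rw [h.modalVec_real B hκ] at e
    have := congrArg Complex.im e
    simp only [Function.comp_apply, Complex.ofReal_im] at this
    exact this

end Connectivity

end

/-! ### The two implications between connectivity and the polar condition. -/

section

open Filter Topology

section Synchronization

variable {n q p m : ℕ} {A : Matrix (Fin n) (Fin n) ℝ} (B : Fin q → Fin p → Fin n → ℝ)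
  {μ : Fin m → ℂ} {d : Fin m → ℕ} {U : ∀ κ, Matrix (Fin n) (Fin (d κ)) ℂ}
  {N : ∀ κ, Matrix (Fin (d κ)) (Fin (d κ)) ℂ} {k l : Fin q}

/-- Connectivity of all modes forces the components `k` and `l` of a vector of the polar to
coincide. -/
theorem eq_of_realResp_nonpos (hμ_inj : Function.Injective μ)
    (hμ_range : spectrum ℂ (adj A) ⊆ Set.range μ)
    (hμ_order : ∀ κ ν, κ ≤ ν → (μ ν).re ≤ (μ κ).re)
    (hμ_real : ∀ κ ν, κ ≠ ν → ((μ κ).re : ℂ) = μ ν → ν < κ)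
    (hmode : ∀ κ, IsMode A (μ κ) (U κ) (N κ))
    (hassume : ∀ κ, (μ κ).im ≠ 0 → (∃ ν, ((μ κ).re : ℂ) = μ ν) → nilPart (μ κ) (N κ) = 0)
    (hreal : ∀ κ, (μ κ).im = 0 → IsStronglyConn k l (modeMatrix B μ U N κ))
    (hnonreal : ∀ κ, (μ κ).im ≠ 0 → IsConn k l (modeMatrix B μ U N κ))
    {η : Fin q × Fin n → ℝ} (hη : ∀ σ, ∀ t, 0 ≤ t → realResp A B σ η t ≤ 0) (j : Fin n) :
    η (k, j) = η (l, j) := by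
  classical
  obtain ⟨c, hc⟩ := exists_blk_modal_sum hμ_range hmode (Complex.ofReal ∘ η)
  set I := indexSet μ (fun κ => nilPart (μ κ) (N κ)) (fun κ => modalB (U κ) B) with hI
  set g : Fin p → Fin m → ℕ → ℂ := fun σ κ r =>
    star (modalVec (nilPart (μ κ) (N κ)) (modalB (U κ) B) r σ) ⬝ᵥ c κ with hg
  have hexp : ∀ σ, ∀ t : ℝ, (realResp A B σ η t : ℂ) =
      ∑ κ, Complex.exp (μ κ * t) * (expPoly (d κ) (g σ κ)).eval (t : ℂ) := by
    intro σ t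
    rw [← resp_ofReal, hc, resp_sum]
    exact Finset.sum_congr rfl fun κ _ => (hmode κ).resp_mode B σ (c κ) t
  have hanti : Antitone I := indexSet_antitone _ _ _
  -- The two claims are proved together: the vanishing for the inputs surviving mode `κ`, that is,
  -- those in `I (κ + 1)`, removes the faster terms at later modes.
  have key : ∀ κ : Fin m, (∀ σ ∈ I (κ + 1), expPoly (d κ) (g σ κ) = 0) ∧
      ∀ j, c κ (k, j) = c κ (l, j) := by
    intro κ
    induction κ using WellFoundedLT.induction with
    | ind κ ih =>
    have hprev : ∀ σ ∈ I κ, ∀ κ' : Fin m, κ' < κ → expPoly (d κ') (g σ κ') = 0 := fun σ hσ κ' hκ' =>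
      (ih κ' hκ').1 σ (hanti (Nat.succ_le_of_lt hκ') hσ)
    have hgt : ∀ σ ∈ I κ, ∀ κ', (μ κ).re < (μ κ').re → expPoly (d κ') (g σ κ') = 0 := by
      intro σ hσ κ' hlt
      refine hprev σ hσ κ' ?_
      by_contra hle
      exact absurd (hμ_order κ κ' (not_lt.mp hle)) (not_le.mpr hlt)
    by_cases him : (μ κ).im = 0
    · have h := hmode κ
      have hμκ : μ κ = ((μ κ).re : ℂ) := Complex.ext rfl (by simpa using him)
      set cr : Fin q × Fin (d κ) → ℝ := fun a => (c κ a).re with hcr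
      have hcκ : c κ = Complex.ofReal ∘ cr := blk_modal_sum_real hμ_inj hmode hc him
      set v : ℕ → Fin p → Fin q × Fin (d κ) → ℝ :=
        fun r σ a => (modalVec (nilPart (μ κ) (N κ)) (modalB (U κ) B) r σ a).re with hv
      set gr : Fin p → ℕ → ℝ := fun σ r => v r σ ⬝ᵥ cr with hgr
      have hggr : ∀ σ r, g σ κ r = gr σ r := by
        intro σ r
        simp only [hg]
        rw [hcκ, h.dotProduct_real B him]
      have hpoly : ∀ σ, expPoly (d κ) (g σ κ) =
          (expPoly (d κ) (gr σ)).map Complex.ofRealHom := by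
        intro σ
        ext r
        rw [Polynomial.coeff_map, expPoly_coeff, expPoly_coeff, hggr]
        split_ifs <;> simp
      have hgr0 : ∀ σ r, d κ ≤ r → gr σ r = 0 := by
        intro σ r hr
        have : v r σ = 0 := by
          ext a
          simp [hv, h.modalVec_eq_zero B hr]
        rw [hgr]
        simp only [this, zero_dotProduct]
      -- Nonreal terms of the same real part are constant, since `Λ = 0` kills their coefficients
      -- with `r > 0`.
      have hlc : ∀ σ ∈ I κ, (expPoly (d κ) (gr σ)).leadingCoeff ≤ 0 := by
        intro σ hσ
        have := leadingCoeff_real_nonpos hμ_inj (hη σ) (hexp σ) (hgt σ hσ) (k := κ)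
          (fun κ' hre him' => by
            have hΛ := hassume κ' him' ⟨κ, by rw [hre, ← hμκ]⟩
            refine Nat.le_zero.mp (Polynomial.natDegree_le_iff_coeff_eq_zero.mpr fun r hr => ?_)
            rw [expPoly_coeff]
            split_ifs with hrd
            · have : g σ κ' r = 0 := by
                simp only [hg]
                rw [modalVec_eq, hΛ, zero_pow hr.ne', blk_zero, Matrix.zero_mulVec, star_zero,
                  zero_dotProduct]
              rw [this, zero_div]
            · rfl) hμκ
        rw [hpoly, Polynomial.leadingCoeff_map] at this
        simpa using this
      choose c' hc' hc'inj using fun t => h.exists_shift B him t cr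
      -- For large `t` the translate lies in the polar of the cone, its pairings being the values at
      -- `t` of the derivatives of the response polynomials.
      have hpolar : ∀ᶠ t in atTop, ∀ σ ∈ I κ, ∀ r ∈ Finset.range (d κ), v r σ ⬝ᵥ c' t ≤ 0 := by
        rw [eventually_all_finset]
        intro σ hσ
        rw [eventually_all_finset]
        intro r _
        filter_upwards [eventually_expPoly_shift_nonpos (hgr0 σ) (hlc σ hσ) r] with t ht
        exact (hc' t r σ).trans_le ht
      constructor
      · intro σ hσ
        rw [hI, indexSet_succ, mem_sdiff_removed him] at hσ
        obtain ⟨hσI, hσl⟩ := hσ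
        rw [hpoly]
        by_contra hne
        have hne' : expPoly (d κ) (gr σ) ≠ 0 := fun h0 => hne (by rw [h0, Polynomial.map_zero])
        -- At such a `t`, chosen not to be a root, the lineality condition for `r = 0` still forces
        -- the value of the polynomial at `t` to vanish.
        obtain ⟨t, ht, htr⟩ := (hpolar.and
          ((expPoly (d κ) (gr σ)).eventually_atTop_not_isRoot hne')).exists
        have hd : 0 < d κ := by
          by_contra hd
          refine hne' ((expPoly_eq_zero_iff _ _).mpr fun r hr => ?_)
          omega
        refine htr ((hc' t 0 σ).symm.trans ?_)
        refine dotProduct_eq_zero_of_mem_lineal (fun i => ?_) (hσl 0 hd)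
        rw [inc_modalQ_re_col]
        exact ht _ i.1.2 _ (Finset.mem_range.mpr i.2.2)
      · obtain ⟨t, ht⟩ := hpolar.exists
        have := (isStronglyConn_modeMatrix_iff B k l h him).mp (hreal κ him) (c' t)
          fun σ hσ r hr => ht σ hσ r (Finset.mem_range.mpr hr)
        intro j
        rw [hcκ]
        exact congrArg Complex.ofReal (hc'inj t k l this j)
    · have hz : ∀ σ ∈ I κ, expPoly (d κ) (g σ κ) = 0 := by
        intro σ hσ
        -- A real eigenvalue of the same real part precedes `κ`, so its term is already known to
        -- vanish.
        refine eq_zero_of_real_eq_zero hμ_inj (hη σ) (hexp σ) (hgt σ hσ) (fun ν hν => ?_) rfl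
        refine hprev σ hσ ν (hμ_real κ ν ?_ hν.symm)
        rintro rfl
        exact him (by rw [hν, Complex.ofReal_im])
      refine ⟨fun σ hσ => hz σ (hanti (Nat.le_succ _) hσ), ?_⟩
      exact (isConn_modeMatrix_iff B k l κ).mp (hnonreal κ him) (c κ) fun σ hσ =>
        (expPoly_eq_zero_iff _ _).mp (hz σ hσ)
  have e : ∀ i, (η (i, j) : ℂ) = ∑ κ, (U κ *ᵥ fun j => c κ (i, j)) j := by
    intro i
    have := congrFun hc (i, j)
    simp only [Function.comp_apply] at this
    rw [this]
    simp [Finset.sum_apply, blk_mulVec_apply]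
  apply Complex.ofReal_injective
  rw [e, e]
  refine Finset.sum_congr rfl fun κ _ => ?_
  rw [funext (key κ).2]

/-- If the polar forces the components `k` and `l` to coincide, so does the weaker set of
inequalities for the inputs of an index set, as long as the responses to the inputs removed so far
grow at most like the modes which removed them. -/
theorem eq_of_realResp_le (hμ_inj : Function.Injective μ)
    (hμ_order : ∀ κ ν, κ ≤ ν → (μ ν).re ≤ (μ κ).re)
    (hmode : ∀ κ, IsMode A (μ κ) (U κ) (N κ))
    (hpolar : ∀ η : Fin q × Fin n → ℝ, (∀ σ, ∀ t, 0 ≤ t → realResp A B σ η t ≤ 0) →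
      ∀ j, η (k, j) = η (l, j)) (i : ℕ) :
    ∀ η : Fin q × Fin n → ℝ,
      (∀ σ ∈ indexSet μ (fun κ => nilPart (μ κ) (N κ)) (fun κ => modalB (U κ) B) i,
        ∀ t, 0 ≤ t → realResp A B σ η t ≤ 0) →
      (∀ ν : Fin m, (ν : ℕ) < i → (μ ν).im = 0 → ∀ σ, ∃ C : ℝ, ∀ t, 0 ≤ t →
        realResp A B σ η t ≤ C * Real.exp ((μ ν).re * t)) →
      ∀ j, η (k, j) = η (l, j) := by
  induction i with
  | zero => exact fun η h0 _ => hpolar η fun σ => h0 σ (Finset.mem_univ σ)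
  | succ i ih =>
    intro η h0 hgrowth
    by_cases him : i < m
    swap
    · rw [indexSet_succ_of_le _ _ _ (not_lt.mp him)] at h0
      exact ih η h0 fun ν hν => hgrowth ν (by omega)
    set κ : Fin m := ⟨i, him⟩ with hκ
    change ∀ σ ∈ indexSet μ _ _ ((κ : ℕ) + 1), _ at h0
    by_cases hκr : (μ κ).im = 0
    swap
    · rw [indexSet_succ_of_nonreal _ _ _ hκr] at h0
      exact ih η h0 fun ν hν => hgrowth ν (by omega)
    rw [indexSet_succ] at h0
    obtain ⟨w, hwkept, hwrem, hwgrowth⟩ := (hmode κ).exists_removing_vector B hκr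
      (indexSet μ (fun κ => nilPart (μ κ) (N κ)) (fun κ => modalB (U κ) B) κ)
    -- Inputs kept at `κ` do not feel `w`. For the removed ones, `M ≥ C / ε` lets the negative
    -- response of `w` dominate that of `η`.
    have hM : ∀ᶠ M : ℝ in atTop, ∀ σ,
        σ ∈ indexSet μ (fun κ => nilPart (μ κ) (N κ)) (fun κ => modalB (U κ) B) κ →
        ∀ t, 0 ≤ t → realResp A B σ (η + M • w) t ≤ 0 := by
      rw [eventually_all]
      intro σ
      by_cases hσ : σ ∈ indexSet μ (fun κ => nilPart (μ κ) (N κ)) (fun κ => modalB (U κ) B) κ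
      swap
      · exact Eventually.of_forall fun M h => absurd h hσ
      by_cases hσk : σ ∈ indexSet μ (fun κ => nilPart (μ κ) (N κ)) (fun κ => modalB (U κ) B) κ \
          removed (μ κ) (nilPart (μ κ) (N κ)) (modalB (U κ) B)
            (indexSet μ (fun κ => nilPart (μ κ) (N κ)) (fun κ => modalB (U κ) B) κ)
      · refine Eventually.of_forall fun M _ t ht => ?_
        rw [realResp_add, realResp_smul, hwkept σ hσk t, mul_zero, add_zero]
        exact h0 σ hσk t ht
      · obtain ⟨ε, hε, hneg⟩ := hwrem σ hσ hσk
        obtain ⟨C, hC⟩ := hgrowth κ (Nat.lt_succ_self i) hκr σ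
        filter_upwards [eventually_ge_atTop (C / ε), eventually_ge_atTop 0] with M hMC hM0 _ t ht
        rw [div_le_iff₀ hε] at hMC
        rw [realResp_add, realResp_smul]
        calc _ ≤ C * Real.exp ((μ κ).re * t) + M * (-ε * Real.exp ((μ κ).re * t)) :=
              add_le_add (hC t ht) (mul_le_mul_of_nonneg_left (hneg t ht) hM0)
          _ = (C - M * ε) * Real.exp ((μ κ).re * t) := by ring
          _ ≤ 0 := mul_nonpos_of_nonpos_of_nonneg (by linarith) (Real.exp_pos _).le
    obtain ⟨M₀, hM₀⟩ := eventually_atTop.mp (hM.and (eventually_ge_atTop 0))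
    have hsync : ∀ M ≥ M₀, ∀ j, (η + M • w) (k, j) = (η + M • w) (l, j) := by
      intro M hMM
      refine ih _ (hM₀ M hMM).1 fun ν hν hνr σ => ?_
      obtain ⟨C, hC⟩ := hgrowth ν (by omega) hνr σ
      -- Distinct real eigenvalues have distinct real parts. This strict gap absorbs the polynomial
      -- factor in the response to `w`.
      have hlt : (μ κ).re < (μ ν).re := by
        refine lt_of_le_of_ne (hμ_order ν κ (le_of_lt hν)) fun hre => ?_
        have : κ = ν := hμ_inj (Complex.ext hre (hκr.trans hνr.symm))
        rw [← this] at hν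
        exact lt_irrefl _ hν
      obtain ⟨C', hC'⟩ := hwgrowth _ hlt σ
      refine ⟨C + M * C', fun t ht => ?_⟩
      rw [realResp_add, realResp_smul, add_mul, mul_assoc]
      exact add_le_add (hC t ht) (mul_le_mul_of_nonneg_left
        ((le_abs_self _).trans (hC' t ht)) (hM₀ M hMM).2)
    intro j
    have h1 := hsync M₀ le_rfl j
    -- Two admissible values of `M` separate `w` from `η`.
    have h2 := hsync (M₀ + 1) (by linarith) j
    simp only [Pi.add_apply, Pi.smul_apply, smul_eq_mul] at h1 h2
    have h3 : w (k, j) = w (l, j) := by linarith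
    rw [h3] at h1
    linarith

/-- A polar vector of the cone at `κ` lifts to a combination of generalized eigenvectors with
nonpositive responses for the current inputs. Earlier real modes are strictly faster, so the growth
condition of `eq_of_realResp_le` holds. -/
theorem isStronglyConn_modeMatrix (hμ_inj : Function.Injective μ)
    (hμ_order : ∀ κ ν, κ ≤ ν → (μ ν).re ≤ (μ κ).re)
    (hmode : ∀ κ, IsMode A (μ κ) (U κ) (N κ))
    (hpolar : ∀ η : Fin q × Fin n → ℝ, (∀ σ, ∀ t, 0 ≤ t → realResp A B σ η t ≤ 0) →
      ∀ j, η (k, j) = η (l, j)) {κ : Fin m} (hκ : (μ κ).im = 0) :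
    IsStronglyConn k l (modeMatrix B μ U N κ) := by
  have h := hmode κ
  refine (isStronglyConn_modeMatrix_iff B k l h hκ).mpr fun c hc j => ?_
  have := eq_of_realResp_le B hμ_inj hμ_order hmode hpolar κ
    (blk q ((U κ).map Complex.re) *ᵥ c)
    (fun σ hσ t ht => h.realResp_nonpos B hκ (hc σ hσ) ht)
    (fun ν hν hνr σ => by
      have hlt : (μ κ).re < (μ ν).re := by
        refine lt_of_le_of_ne (hμ_order ν κ (le_of_lt hν)) fun hre => ?_
        have : κ = ν := hμ_inj (Complex.ext hre (hκ.trans hνr.symm))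
        rw [← this] at hν
        exact lt_irrefl _ hν
      obtain ⟨C, hC⟩ := h.exists_abs_realResp_le B hκ hlt σ c
      exact ⟨C, fun t ht => (le_abs_self _).trans (hC t ht)⟩)
  have h2 := h.blk_injective (c := Complex.ofReal ∘ c) (k := k) (l := l) (fun j => by
    rw [h.blk_ofReal hκ]
    exact congrArg Complex.ofReal (this j)) j
  exact Complex.ofReal_injective h2

/-- A vector orthogonal to the columns lifts to one with zero response to the current inputs, so its
real and imaginary parts can be treated separately by `eq_of_realResp_le`. If an earlier real mode
has the same real part, the growth condition rests on `Λ = 0`. -/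
theorem isConn_modeMatrix (hμ_inj : Function.Injective μ)
    (hμ_order : ∀ κ ν, κ ≤ ν → (μ ν).re ≤ (μ κ).re)
    (hmode : ∀ κ, IsMode A (μ κ) (U κ) (N κ))
    (hassume : ∀ κ, (μ κ).im ≠ 0 → (∃ ν, ((μ κ).re : ℂ) = μ ν) → nilPart (μ κ) (N κ) = 0)
    (hpolar : ∀ η : Fin q × Fin n → ℝ, (∀ σ, ∀ t, 0 ≤ t → realResp A B σ η t ≤ 0) →
      ∀ j, η (k, j) = η (l, j)) {κ : Fin m} (hκ : (μ κ).im ≠ 0) :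
    IsConn k l (modeMatrix B μ U N κ) := by
  have h := hmode κ
  refine (isConn_modeMatrix_iff B k l κ).mpr fun c hc => ?_
  set v := blk q (U κ) *ᵥ c with hv
  have hre : ∀ σ t, realResp A B σ (fun a => (v a).re) t = (resp A B σ v t).re := by
    intro σ t; rw [resp_eq]; simp
  have him : ∀ σ t, realResp A B σ (fun a => (v a).im) t = (resp A B σ v t).im := by
    intro σ t; rw [resp_eq]; simp
  have hzero : ∀ σ ∈ indexSet μ (fun κ => nilPart (μ κ) (N κ)) (fun κ => modalB (U κ) B) κ,
      ∀ t, resp A B σ v t = 0 := by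
    intro σ hσ t
    rw [hv, h.resp_mode, (expPoly_eq_zero_iff _ _).mpr (hc σ hσ), Polynomial.eval_zero, mul_zero]
  have hgrowth : ∀ ν : Fin m, (ν : ℕ) < κ → (μ ν).im = 0 → ∀ σ, ∃ C : ℝ, ∀ t, 0 ≤ t →
      ‖resp A B σ v t‖ ≤ C * Real.exp ((μ ν).re * t) := by
    intro ν hν hνr σ
    rcases (hμ_order ν κ (le_of_lt hν)).lt_or_eq with hlt | heq
    · exact h.exists_norm_resp_le B hlt σ c
    · rw [← heq]
      exact h.exists_norm_resp_le_of_nilPart_eq_zero B (hassume κ hκ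
        ⟨ν, Complex.ext (by simpa using heq) (by simpa using hνr.symm)⟩) σ c
  have hsre := eq_of_realResp_le B hμ_inj hμ_order hmode hpolar κ (fun a => (v a).re)
    (fun σ hσ t _ => by rw [hre, hzero σ hσ, Complex.zero_re])
    (fun ν hν hνr σ => by
      obtain ⟨C, hC⟩ := hgrowth ν hν hνr σ
      exact ⟨C, fun t ht => (hre σ t).trans_le ((Complex.re_le_norm _).trans (hC t ht))⟩)
  have hsim := eq_of_realResp_le B hμ_inj hμ_order hmode hpolar κ (fun a => (v a).im)
    (fun σ hσ t _ => by rw [him, hzero σ hσ, Complex.zero_im])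
    (fun ν hν hνr σ => by
      obtain ⟨C, hC⟩ := hgrowth ν hν hνr σ
      exact ⟨C, fun t ht => (him σ t).trans_le ((Complex.im_le_norm _).trans (hC t ht))⟩)
  exact h.blk_injective fun j => Complex.ext (hsre j) (hsim j)

end Synchronization

end

end RelArray

end

/-! ### Assembly of the equivalence. -/

theorem theorem4 {n q p m : ℕ}
    -- the array, with relative actuation
    (A : Matrix (Fin n) (Fin n) ℝ) (B : Fin q → Fin p → Fin n → ℝ)
    (hB : ∀ σ, ∑ i, B i σ = 0)
    -- the distinct eigenvalues of `A*`, ordered by real part, a real eigenvalue preceding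
    -- the non-real ones with the same real part
    (μ : Fin m → ℂ) (hμ_inj : Function.Injective μ)
    (hμ_range : Set.range μ = spectrum ℂ (RelArray.adj A))
    (hμ_order : ∀ κ ν, κ ≤ ν → (μ ν).re ≤ (μ κ).re)
    (hμ_real : ∀ κ ν, κ ≠ ν → ((μ κ).re : ℂ) = μ ν → ν < κ)
    -- their algebraic multiplicities
    (d : Fin m → ℕ) (hd : ∀ κ, d κ = (RelArray.adj A).charpoly.rootMultiplicity (μ κ))
    -- matrices of generalized eigenvectors, real for real eigenvalues
    (U : ∀ κ, Matrix (Fin n) (Fin (d κ)) ℂ)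
    (hU_rank : ∀ κ, LinearIndependent ℂ (U κ).col)
    (hU_range : ∀ κ, LinearMap.range (U κ).mulVecLin =
      LinearMap.ker (((RelArray.adj A - μ κ • (1 : Matrix (Fin n) (Fin n) ℂ)) ^ d κ).mulVecLin))
    (hU_real : ∀ κ, (μ κ).im = 0 → ∀ a b, (U κ a b).im = 0)
    -- the matrices `N κ = A_κ`, determined by `A* U_κ = U_κ A_κ*`
    (N : ∀ κ, Matrix (Fin (d κ)) (Fin (d κ)) ℂ)
    (hN : ∀ κ, RelArray.adj A * U κ = U κ * (N κ)ᴴ)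
    (k l : Fin q) (hkl : k ≠ l)
    -- the standing assumption on non-real eigenvalues
    (hassume : ∀ κ, (μ κ).im ≠ 0 → (∃ ν, ((μ κ).re : ℂ) = μ ν) →
      RelArray.nilPart (μ κ) (N κ) = 0) :
    RelArray.polar (RelArray.posReach A B) ⊆
        (LinearMap.ker ((RelArray.diffBlock ℝ k l n)ᵀ.mulVecLin) : Set (Fin q × Fin n → ℝ)) ↔
      (∀ κ, (μ κ).im = 0 → RelArray.IsStronglyConn k l (RelArray.modeMatrix B μ U N κ)) ∧
      (∀ κ, (μ κ).im ≠ 0 → RelArray.IsConn k l (RelArray.modeMatrix B μ U N κ)) := by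
  have hmode : ∀ κ, RelArray.IsMode A (μ κ) (U κ) (N κ) := fun κ =>
    ⟨hU_rank κ, hU_range κ, hd κ, hN κ, hU_real κ⟩
  constructor
  · intro h
    have hpolar : ∀ η : Fin q × Fin n → ℝ,
        (∀ σ, ∀ t, 0 ≤ t → RelArray.realResp A B σ η t ≤ 0) → ∀ j, η (k, j) = η (l, j) :=
      fun η hη => (RelArray.mem_ker_diffBlock_transpose k l η).mp
        (h ((RelArray.mem_polar_posReach_iff A B η).mpr hη))
    exact ⟨fun κ hκ => RelArray.isStronglyConn_modeMatrix B hμ_inj hμ_order hmode hpolar hκ,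
      fun κ hκ => RelArray.isConn_modeMatrix B hμ_inj hμ_order hmode hassume hpolar hκ⟩
  · rintro ⟨hreal, hnonreal⟩ η hη
    exact (RelArray.mem_ker_diffBlock_transpose k l η).mpr
      (RelArray.eq_of_realResp_nonpos B hμ_inj hμ_range.ge hμ_order hμ_real hmode hassume hreal
        hnonreal ((RelArray.mem_polar_posReach_iff A B η).mp hη))
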